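/- **Theorem 1.2 (A Senatov–Zolotarev type $\zeta_1\vee\zeta_{2,\delta}$ Theorem).** *Notation.* For $r\ge 2$ let $\mathcal P_r$ be the set of all probability measures (laws) $P$ on the Borel sets of $\mathbb R$ with $\int|x|^r\,\mathrm dP(x)<\infty$ and with standard deviation $\sigma(P)>0$. For $P\in\mathcal P_2$ with mean $\mu(P)$, the standardisation $\widetilde P$ is the law of $(X-\mu(P))/\sigma(P)$, where $X$ has the law $P$. $P^{*n}$ is the $n$-fold convolution power of $P$, $\mathrm N$ is the standard normal law, and $\mathbb N=\{1,2,3,\dots\}$. For $m\in\{0,1,2,\dots\}$ and $g:[0,\infty)\to[0,\infty)$ let $\mathcal F^\infty_{m,g}$ be the set of all bounded measurable, $m$ times differentiable $f:\mathbb R\to\mathbb R$ with $|f^{(m)}(x)-f^{(m)}(y)|\le g(|x-y|)$ for all $x,y\in\mathbb R$, and for a bounded signed Borel measure $M$ on $\mathbb R$ put $$\zeta_{m,g}(M)=\sup\Big\{\Big|\int f\,\mathrm dM\Big| : f\in\mathcal F^\infty_{m,g}\Big\}\in[0,\infty].$$ Put $\zeta_1=\zeta_{0,g}$ with $g(u)=u$,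 and, for $\delta\in[0,1]$, $\zeta_{2,\delta}=\zeta_{2,g}$ with $g(u)=\min(u,u^\delta)$. For $\delta\in[0,1]$ put $$\alpha_\delta=\Big(\tfrac{16e^{-1/2}-4}{\sqrt{2\pi}}\Big)^{1-\delta}\Big(\tfrac{4e^{-1/2}}{\sqrt{2\pi}}\Big)^{\delta},\quad \beta=\tfrac{4}{\sqrt{2\pi}},\quad \gamma_\delta=\Big(\tfrac{8e^{-1/2}}{\sqrt{2\pi}}\Big)^{1-\delta}\Big(\tfrac{2+8e^{-3/2}}{\sqrt{2\pi}}\Big)^{\delta},$$ $$g_\delta(\eta)=2\,\frac{(1+\eta^2)^{\frac{1-\delta}{2}}}{\eta}\quad(\eta\in(0,\infty)),$$ and, for $\varkappa,\zeta\in[0,\infty)$, with $\inf\emptyset=\infty$, $$\xi_\delta(\varkappa,\zeta)=\inf\Big\{\frac{\varkappa+\alpha_\delta\zeta+\beta\eta}{1-\gamma_\delta g_\delta(\eta)\zeta} : \eta\in(0,\infty),\ \gamma_\delta g_\delta(\eta)\zeta<1\Big\}\in[0,\infty].$$ (a) Let $\delta\in[0,1]$. For every $P\in\mathcal P_{2+\delta}$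 the numbers $\zeta_1(\widetilde P-\mathrm N)$ and $\zeta_{2,\delta}(\widetilde P-\mathrm N)$ are finite, and for every $n\in\mathbb N$ $$\zeta_1\big(\widetilde{P^{*n}}-\mathrm N\big)\le\frac{1}{n^{\delta/2}}\,\xi_\delta\Big(\zeta_1(\widetilde P-\mathrm N),\,\zeta_{2,\delta}(\widetilde P-\mathrm N)\Big).$$ Moreover, $\xi_\delta(\varkappa,\zeta)=\infty$ only if $\delta=0$ and $\zeta\ge(2\gamma_0)^{-1}=0.2582\ldots$. (b) Put $\alpha=\frac{16e^{-1/2}-4}{\sqrt{2\pi}}$, $\beta=\frac{4}{\sqrt{2\pi}}$, $\gamma=\frac{8e^{-1/2}}{\sqrt{2\pi}}$. Let $(\theta,c)\in(0,1)\times(0,\infty)$ satisfy $\frac{\theta^2}{4\gamma^2}-\frac1{c^2}>0$. Then, for every $\delta\in[0,1]$, every $P\in\mathcal P_2$ with $\zeta_{2,\delta}(\widetilde P-\mathrm N)\le\sqrt{\frac{\theta^2}{4\gamma^2}-\frac1{c^2}}$, and every $n\in\mathbb N$, $$\zeta_1\big(\widetilde{P^{*n}}-\mathrm N\big)\le\frac{1+\alpha+\beta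 c}{1-\theta}\cdot\frac{\max\big\{\zeta_1(\widetilde P-\mathrm N),\,\zeta_{2,\delta}(\widetilde P-\mathrm N)\big\}}{n^{\delta/2}}.$$ -/

import Mathlib

open MeasureTheory ProbabilityTheory Set
open scoped NNReal ENNReal

noncomputable section

namespace SenatovZolotarev

/-! ### Laws on the real line -/

/-- The absolute moment `ν_r(P) = ∫ |x|^r dP(x) ∈ [0, ∞]` of real order `r` of a measure on `ℝ`. -/
def absMoment (r : ℝ) (P : Measure ℝ) : ℝ≥0∞ :=
  ∫⁻ x, ENNReal.ofReal (|x| ^ r) ∂P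

/-- The mean `μ(P)`. -/
def mean (P : Measure ℝ) : ℝ := ∫ x, x ∂P

/-- The standard deviation `σ(P)`. -/
def stdDev (P : Measure ℝ) : ℝ := Real.sqrt (Var[id; P])

/-- The class `𝒫_r` (used for `r ≥ 2`): laws on `ℝ` with a finite absolute moment of order `r`
and with nonzero standard deviation. -/
def MemP (r : ℝ) (P : Measure ℝ) : Prop :=
  IsProbabilityMeasure P ∧ absMoment r P < ∞ ∧ 0 < stdDev P

/-- The standardisation of `P`: the law of `(X - μ(P)) / σ(P)` if `X` has the law `P`. -/
def standardize (P : Measure ℝ) : Measure ℝ :=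
  P.map (fun x => (x - mean P) / stdDev P)

instance (P : Measure ℝ) [IsProbabilityMeasure P] : IsProbabilityMeasure (standardize P) :=
  Measure.isProbabilityMeasure_map (by fun_prop)

/-- The convolution power `P^{*n}`, with `P^{*0}` the Dirac measure at `0`. -/
def convPow (P : Measure ℝ) : ℕ → Measure ℝ
  | 0 => Measure.dirac 0
  | n + 1 => Measure.conv (convPow P n) P

instance (P : Measure ℝ) [IsProbabilityMeasure P] (n : ℕ) : IsProbabilityMeasure (convPow P n) := by
  induction n with
  | zero => unfold convPow; infer_instance
  | succ n ih => unfold convPow; infer_instance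

/-- The bounded signed measure `P - N`, with `N` the standard normal law. -/
def subNormal (P : Measure ℝ) [IsFiniteMeasure P] : SignedMeasure ℝ :=
  P.toSignedMeasure - (gaussianReal 0 1).toSignedMeasure

/-! ### The Zolotarev type enorms -/

/-- The set `ℱ_{m,g}^∞`: bounded measurable functions `f : ℝ → ℝ` that are `m` times differentiable
(the `m`th derivative existing everywhere) with `|f^(m)(x) - f^(m)(y)| ≤ g(|x - y|)`. -/
def testFun (m : ℕ) (g : ℝ → ℝ) : Set (ℝ → ℝ) :=
  {f | Measurable f ∧ (∃ C : ℝ, ∀ x, |f x| ≤ C) ∧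
    (∀ k < m, Differentiable ℝ (iteratedDeriv k f)) ∧
    ∀ x y, |iteratedDeriv m f x - iteratedDeriv m f y| ≤ g |x - y|}

/-- The enorm `ζ_{m,g}(M) = sup {|∫ f dM| : f ∈ ℱ_{m,g}^∞} ∈ [0, ∞]` of a bounded signed
measure `M` on `ℝ`. -/
def zeta (m : ℕ) (g : ℝ → ℝ) (M : SignedMeasure ℝ) : ℝ≥0∞ :=
  ⨆ f ∈ testFun m g, ENNReal.ofReal |∫ᵛ x, f x ∂<•M|

/-- `ζ₁ = ζ_{0,g}` with `g(u) = u`. -/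
def zeta1 (M : SignedMeasure ℝ) : ℝ≥0∞ := zeta 0 (fun u => u) M

/-- `ζ_{2,δ} = ζ_{2,g}` with `g(u) = min(u, u^δ)`. -/
def zeta2 (δ : ℝ) (M : SignedMeasure ℝ) : ℝ≥0∞ := zeta 2 (fun u => min u (u ^ δ)) M

/-! ### The explicit constants and the function `ξ_δ` -/

/-- The constant `α`. -/
def alphaC : ℝ := (16 * Real.exp (-1 / 2) - 4) / Real.sqrt (2 * Real.pi)

/-- The constant `β`. -/
def betaC : ℝ := 4 / Real.sqrt (2 * Real.pi)

/-- The constant `γ`. -/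
def gammaC : ℝ := 8 * Real.exp (-1 / 2) / Real.sqrt (2 * Real.pi)

/-- The constant `α_δ`. -/
def alphaD (δ : ℝ) : ℝ :=
  ((16 * Real.exp (-1 / 2) - 4) / Real.sqrt (2 * Real.pi)) ^ (1 - δ) *
    (4 * Real.exp (-1 / 2) / Real.sqrt (2 * Real.pi)) ^ δ

/-- The constant `γ_δ`. -/
def gammaD (δ : ℝ) : ℝ :=
  (8 * Real.exp (-1 / 2) / Real.sqrt (2 * Real.pi)) ^ (1 - δ) *
    ((2 + 8 * Real.exp (-3 / 2)) / Real.sqrt (2 * Real.pi)) ^ δ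

/-- The function `g_δ(η) = 2 (1 + η²)^{(1-δ)/2} / η`, for `η > 0`. -/
def gD (δ η : ℝ) : ℝ := 2 * ((1 + η ^ 2) ^ ((1 - δ) / 2) / η)

/-- The function `ξ_δ : [0, ∞)² → [0, ∞]`; the infimum of the empty set is `∞`. -/
def xi (δ : ℝ) (κ ζ : ℝ≥0) : ℝ≥0∞ :=
  ⨅ (η : ℝ) (_ : 0 < η) (_ : gammaD δ * gD δ η * (ζ : ℝ) < 1),
    ENNReal.ofReal
      (((κ : ℝ) + alphaD δ * (ζ : ℝ) + betaC * η) / (1 - gammaD δ * gD δ η * (ζ : ℝ)))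

end SenatovZolotarev

end

/-! The proof is Lindeberg's replacement method combined with Gaussian smoothing and a self-bounding
induction. Let `Q` be the standardised law, `N_v` the centred normal law of variance `v`, and `f`
bounded and 1-Lipschitz. It suffices to bound the integral of `f` against `Q^{*n} - N_n` by
`n^((1-δ)/2) * X`, where `X` is one of the quotients in the infimum defining `xi`; rescaling by
`1/√n` then turns this into `n^(-δ/2) * X`.

Smoothing `f` by `N_{ε²}` costs at most `betaC * ε`. The smoothed difference telescopes into the
terms `Q^{*k} * (Q - N_1) * N_{ε²+n-1-k}`. The term `k = n - 1` may carry too little smoothing and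
is bounded by `κ` directly. In the others `Q^{*k}` is written as `(Q^{*k} - N_k) + N_k`. The part
with `N_k` tests `Q - N_1` against a function smoothed with variance at least `n - 1`, so its second
derivative varies little; this produces the `alphaD` term
(`SmoothDiffLE.abs_integral_gaussSmooth_le`). In the other part, `Q - N_1` convolved with the
smoothed `f` is Lipschitz with a small constant (`SmoothDiffLE.bddLip_integral_gaussSmooth`), so the
induction hypothesis for `Q^{*k}` applies; this produces the `gammaD` term.

With `ε = η * n^((1-δ)/2)` the Lipschitz constants sum to at most `gammaD δ * gD δ η * ζ`, uniformly
in `n`. The induction closes because `X` solves `κ + α ζ + β η + γ g ζ X = X`, which is where `γ g ζ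
< 1` is needed. `lipDiffLE_convPow` carries this out. -/

noncomputable section

namespace SenatovZolotarev

/-! ### Elementary inequalities -/

/-- Both bounds on `D` are interpolated geometrically with weights `1 - δ` and `δ`, which gives the
factor `u ^ δ`. The factor `u` comes from `D ≤ B * u` alone, and there `B ≤ A` is needed. This lemma
is the source of the geometric form of `alphaD` and `gammaD`. -/
theorem le_interpolation_mul_min {δ A B D u : ℝ} (hδ : δ ∈ Icc (0 : ℝ) 1) (hD : 0 ≤ D)
    (hB : 0 ≤ B) (hu : 0 ≤ u) (hBA : B ≤ A) (hDA : D ≤ A) (hDB : D ≤ B * u) :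
    D ≤ A ^ (1 - δ) * B ^ δ * min u (u ^ δ) := by
  have hA : 0 ≤ A := hB.trans hBA
  obtain ⟨h0, h1⟩ := hδ
  have split : ∀ x : ℝ, 0 ≤ x → x = x ^ (1 - δ) * x ^ δ := fun x hx => by
    rw [← Real.rpow_add_of_nonneg hx (by linarith) h0]; simp
  rw [mul_min_of_nonneg _ _ (by positivity)]
  refine le_min ?_ ?_
  · calc D ≤ B * u := hDB
      _ = B ^ (1 - δ) * B ^ δ * u := by rw [← split B hB]
      _ ≤ _ := by gcongr
  · calc D = D ^ (1 - δ) * D ^ δ := split D hD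
      _ ≤ A ^ (1 - δ) * (B * u) ^ δ := by gcongr
      _ = _ := by rw [Real.mul_rpow hB hu, mul_assoc]

/-- The right side is the integral of `t ^ (-3/2)` over `[x, x + 1]`, and the left side is the
minimum of the integrand there. The proof is algebra in the square roots. -/
theorem inv_rpow_three_half_le {x : ℝ} (hx : 0 < x) :
    (x + 1) ^ (-(3 / 2) : ℝ) ≤ 2 / √x - 2 / √(x + 1) := by
  set s := √x
  set t := √(x + 1)
  have hs : 0 < s := Real.sqrt_pos.2 hx
  have ht : 0 < t := Real.sqrt_pos.2 (by linarith)
  have hs2 : s ^ 2 = x := Real.sq_sqrt hx.le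
  have ht2 : t ^ 2 = x + 1 := Real.sq_sqrt (by linarith)
  have h : (x + 1) ^ (-(3 / 2) : ℝ) = 1 / t ^ 3 := by
    rw [← ht2, ← Real.rpow_natCast t 2, ← Real.rpow_mul ht.le, ← Real.rpow_natCast t 3,
      one_div, ← Real.rpow_neg ht.le]
    norm_num
  have hst : s ≤ t := Real.sqrt_le_sqrt (by linarith)
  rw [h, div_sub_div _ _ hs.ne' ht.ne', div_le_div_iff₀ (by positivity) (by positivity)]
  have h1 : (t - s) * (t + s) = 1 := by ring_nf; linarith
  have h2 : 1 ≤ 2 * t * (t - s) := by nlinarith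
  nlinarith [mul_le_mul_of_nonneg_left h2 (by positivity : 0 ≤ s * t),
    mul_nonneg (sub_nonneg.2 hst) (by positivity : 0 ≤ t ^ 2), mul_pos hs ht]

theorem sum_inv_rpow_three_half_le {A : ℝ} (hA : 0 < A) (m : ℕ) :
    ∑ j ∈ Finset.range m, (A + (j + 1 : ℝ)) ^ (-(3 / 2) : ℝ) ≤ 2 / √A := by
  have h : ∑ j ∈ Finset.range m, (A + (j + 1 : ℝ)) ^ (-(3 / 2) : ℝ) ≤
      2 / √A - 2 / √(A + m) := by
    induction m with
    | zero => simp
    | succ m ih =>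
      rw [Finset.sum_range_succ]
      have := inv_rpow_three_half_le (x := A + m) (by positivity)
      push_cast
      rw [← add_assoc]
      linarith
  exact h.trans (sub_le_self _ (by positivity))

/-- Since `-1 - δ/2 = (1 - δ)/2 - 3/2`, each term is at most its largest possible `(1 - δ)/2` power
times a summand of the telescoping `-3/2` sum. The choice `A = η² n^(1-δ)` makes `√A` carry exactly
the power of `n` that cancels, so the bound is uniform in `n = m + 1`. -/
theorem sum_inv_rpow_le_gD {δ η : ℝ} (hδ : δ ∈ Icc (0 : ℝ) 1) (hη : 0 < η) (m : ℕ) :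
    ∑ j ∈ Finset.range m, (η ^ 2 * (m + 1 : ℝ) ^ (1 - δ) + (j + 1 : ℝ)) ^ (-1 - δ / 2 : ℝ) ≤
      gD δ η := by
  obtain ⟨h0, h1⟩ := hδ
  have hn : (1 : ℝ) ≤ m + 1 := by linarith [m.cast_nonneg (α := ℝ)]
  have hn0 : (0 : ℝ) ≤ m + 1 := by linarith
  set A := η ^ 2 * (m + 1 : ℝ) ^ (1 - δ) with hA
  have hApos : 0 < A := by positivity
  have hsA : √A = η * (m + 1 : ℝ) ^ ((1 - δ) / 2) := by
    rw [hA, Real.sqrt_mul (sq_nonneg _), Real.sqrt_sq hη.le, Real.sqrt_eq_rpow,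
      ← Real.rpow_mul hn0]
    ring_nf
  have hAn : A + (m + 1) ≤ (m + 1) * (1 + η ^ 2) := by
    have : (m + 1 : ℝ) ^ (1 - δ) ≤ m + 1 := by
      simpa using Real.rpow_le_rpow_of_exponent_le hn (by linarith : 1 - δ ≤ 1)
    nlinarith [sq_nonneg η]
  calc ∑ j ∈ Finset.range m, (A + (j + 1 : ℝ)) ^ (-1 - δ / 2 : ℝ)
      ≤ ∑ j ∈ Finset.range m,
          ((m + 1) * (1 + η ^ 2)) ^ ((1 - δ) / 2) * (A + (j + 1 : ℝ)) ^ (-(3 / 2) : ℝ) := by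
        refine Finset.sum_le_sum fun j hj => ?_
        have hjm : (j : ℝ) + 1 ≤ m := by exact_mod_cast Finset.mem_range.1 hj
        have hpos : 0 < A + (j + 1 : ℝ) := by positivity
        rw [show (-1 - δ / 2 : ℝ) = (1 - δ) / 2 + -(3 / 2) by ring, Real.rpow_add hpos]
        gcongr
        · linarith
    _ = ((m + 1) * (1 + η ^ 2)) ^ ((1 - δ) / 2) *
          ∑ j ∈ Finset.range m, (A + (j + 1 : ℝ)) ^ (-(3 / 2) : ℝ) := by rw [Finset.mul_sum]
    _ ≤ ((m + 1) * (1 + η ^ 2)) ^ ((1 - δ) / 2) * (2 / √A) := by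
        gcongr
        exact sum_inv_rpow_three_half_le hApos m
    _ = gD δ η := by
        rw [hsA, gD, Real.mul_rpow hn0 (by positivity)]
        field_simp

/-! ### Sizes of the constants, and where `xi` is infinite -/

theorem alphaD_pos (δ : ℝ) : 0 < alphaD δ := by
  have : 0 < 16 * Real.exp (-1 / 2) - 4 := by
    have := Real.add_one_le_exp (-1 / 2 : ℝ)
    linarith
  unfold alphaD
  positivity

theorem gammaD_pos (δ : ℝ) : 0 < gammaD δ := by
  unfold gammaD
  positivity

theorem half_le_exp_neg_half : 1 / 2 ≤ Real.exp (-1 / 2) := by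
  have := Real.add_one_le_exp (-1 / 2 : ℝ)
  linarith

/-- For the normal density `φ` this says `‖φ'''‖₁ ≤ 2 ‖φ''‖₁`. It supplies `B ≤ A` in the
interpolation for `gammaD`, and also `gammaD δ ≤ gammaC`. -/
theorem norm_third_le_two_mul_norm_second : 2 + 8 * Real.exp (-3 / 2) ≤ 8 * Real.exp (-1 / 2) := by
  have h : Real.exp (-3 / 2) = Real.exp (-1 / 2) * Real.exp (-1) := by
    rw [← Real.exp_add]; norm_num
  have h1 : Real.exp (-1) ≤ 0.4 := by
    have := Real.exp_neg_one_lt_d9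
    linarith
  rw [h]
  nlinarith [half_le_exp_neg_half]

theorem alphaD_le {δ : ℝ} (hδ : δ ∈ Icc (0 : ℝ) 1) : alphaD δ ≤ alphaC := by
  have h := half_le_exp_neg_half
  have hpos : 0 < (16 * Real.exp (-1 / 2) - 4) / √(2 * Real.pi) :=
    div_pos (by linarith) (by positivity)
  calc alphaD δ ≤ alphaC ^ (1 - δ) * alphaC ^ δ := by
        unfold alphaD alphaC
        gcongr
        · exact hδ.1
        · linarith
    _ = alphaC := by
        rw [alphaC, ← Real.rpow_add hpos]; simp

theorem gammaD_le {δ : ℝ} (hδ : δ ∈ Icc (0 : ℝ) 1) : gammaD δ ≤ gammaC := by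
  have hpos : 0 < 8 * Real.exp (-1 / 2) / √(2 * Real.pi) := by positivity
  calc gammaD δ ≤ gammaC ^ (1 - δ) * gammaC ^ δ := by
        unfold gammaD gammaC
        gcongr
        · exact hδ.1
        · exact norm_third_le_two_mul_norm_second
    _ = gammaC := by
        rw [gammaC, ← Real.rpow_add hpos]; simp

theorem gD_le {δ η : ℝ} (hδ : δ ∈ Icc (0 : ℝ) 1) (hη : 0 < η) :
    gD δ η ≤ 2 * √(1 + 1 / η ^ 2) := by
  have h : √(1 + 1 / η ^ 2) = √(1 + η ^ 2) / η := by
    rw [show 1 + 1 / η ^ 2 = (1 + η ^ 2) / η ^ 2 by field_simp; ring,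
      Real.sqrt_div' _ (sq_nonneg _), Real.sqrt_sq hη.le]
  rw [gD, h, Real.sqrt_eq_rpow]
  gcongr
  · nlinarith
  · linarith [hδ.1]

theorem gD_pos {δ η : ℝ} (hη : 0 < η) : 0 < gD δ η := by
  unfold gD
  positivity

open Filter Topology in
theorem tendsto_gD_atTop {δ : ℝ} (hδ : δ ∈ Icc (0 : ℝ) 1) :
    Tendsto (gD δ) atTop (𝓝 (if δ = 0 then 2 else 0)) := by
  have h1 : Tendsto (fun η : ℝ => (1 + 1 / η ^ 2) ^ ((1 - δ) / 2)) atTop (𝓝 1) := by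
    have : Tendsto (fun η : ℝ => 1 + 1 / η ^ 2) atTop (𝓝 (1 + 0)) := by
      refine tendsto_const_nhds.add ?_
      simpa using tendsto_pow_neg_atTop (𝕜 := ℝ) (n := 2) (by norm_num)
    have := this.rpow_const (p := (1 - δ) / 2) (Or.inl (by norm_num))
    simpa using this
  have h2 : Tendsto (fun η : ℝ => η ^ (-δ)) atTop (𝓝 (if δ = 0 then 1 else 0)) := by
    split_ifs with h
    · simp [h]
    · exact tendsto_rpow_neg_atTop (lt_of_le_of_ne hδ.1 (Ne.symm h))
  have h3 := (h1.mul h2).const_mul 2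
  have h4 : (2 * (1 * if δ = 0 then (1 : ℝ) else 0)) = if δ = 0 then 2 else 0 := by
    split_ifs <;> norm_num
  rw [h4] at h3
  refine h3.congr' ?_
  filter_upwards [eventually_gt_atTop 0] with η hη
  have e : 1 + η ^ 2 = (1 + 1 / η ^ 2) * η ^ 2 := by field_simp; ring
  rw [gD, e, Real.mul_rpow (by positivity) (by positivity), mul_div_assoc]
  congr 2
  rw [← Real.rpow_natCast η 2, ← Real.rpow_mul hη.le, ← Real.rpow_sub_one hη.ne']
  congr 1
  push_cast
  ring

/-- An infinite infimum means that no `η` is admissible. Letting `η → ∞` in `1 ≤ γ g(η) ζ` gives a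
contradiction for `δ > 0`, where `g` tends to `0`, and the threshold for `δ = 0`, where `g` tends to
`2`. -/
theorem xi_eq_top {δ : ℝ} (hδ : δ ∈ Icc (0 : ℝ) 1) {κ ζ : ℝ≥0} (h : xi δ κ ζ = ∞) :
    δ = 0 ∧ (2 * gammaD 0)⁻¹ ≤ (ζ : ℝ) := by
  have hnot : ∀ η : ℝ, 0 < η → 1 ≤ gammaD δ * gD δ η * (ζ : ℝ) := by
    intro η hη
    by_contra! hlt
    rw [xi] at h
    simp only [iInf_eq_top] at h
    exact ENNReal.ofReal_ne_top (h η hη hlt)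
  have hlim := ((tendsto_gD_atTop hδ).const_mul (gammaD δ)).mul_const (ζ : ℝ)
  have hge := ge_of_tendsto hlim (Filter.eventually_atTop.2 ⟨1, fun η hη => hnot η (by linarith)⟩)
  by_cases h0 : δ = 0
  · subst h0
    refine ⟨rfl, ?_⟩
    rw [if_pos rfl] at hge
    rw [inv_le_iff_one_le_mul₀ (by have := gammaD_pos 0; positivity)]
    linarith
  · rw [if_neg h0] at hge
    norm_num at hge

theorem inv_two_mul_gammaD_zero_mem : (2 * gammaD 0)⁻¹ ∈ Ico (0.2582 : ℝ) 0.2583 := by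
  have h : (2 * gammaD 0)⁻¹ = √(2 * Real.pi * Real.exp 1 / 256) := by
    rw [Real.sqrt_div' _ (by norm_num), Real.sqrt_mul (by positivity), ← Real.exp_half,
      show √(256 : ℝ) = 16 by rw [Real.sqrt_eq_iff_mul_self_eq] <;> norm_num]
    have : Real.exp (-1 / 2) = (Real.exp (1 / 2))⁻¹ := by rw [← Real.exp_neg]; norm_num
    simp only [gammaD, sub_zero, Real.rpow_one, Real.rpow_zero, mul_one, this]
    field_simp
    norm_num
  rw [h]
  have hp1 := Real.pi_gt_d6
  have hp2 := Real.pi_lt_d6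
  have he1 := Real.exp_one_gt_d9
  have he2 := Real.exp_one_lt_d9
  constructor
  · apply Real.le_sqrt_of_sq_le
    nlinarith
  · rw [Real.sqrt_lt' (by norm_num)]
    nlinarith

/-! ### Convolution with kernels of Gaussian decay -/

/-- Continuous functions dominated by a multiple of `exp (-z² / 4)`. -/
def GaussDecay (K : ℝ → ℝ) : Prop :=
  Continuous K ∧ ∃ C, ∀ z, |K z| ≤ C * Real.exp (-z ^ 2 / 4)

theorem integrable_exp_neg_sq_div {b : ℝ} (hb : 0 < b) (x : ℝ) :
    Integrable fun w : ℝ => Real.exp (-(w - x) ^ 2 / b) := by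
  have h := (integrable_exp_neg_mul_sq (b := 1 / b) (by positivity)).comp_sub_right x
  refine h.congr (ae_of_all _ fun w => ?_)
  simp only
  congr 1
  ring

theorem GaussDecay.integrable {K : ℝ → ℝ} (hK : GaussDecay K) : Integrable K := by
  obtain ⟨hc, C, hC⟩ := hK
  have h := (integrable_exp_neg_sq_div (b := 4) (by norm_num) 0).const_mul C
  simp only [sub_zero] at h
  exact h.mono' hc.aestronglyMeasurable (ae_of_all _ hC)

theorem GaussDecay.integrable_mul {K : ℝ → ℝ} (hK : GaussDecay K) {f : ℝ → ℝ} (hf : Measurable f)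
    {M : ℝ} (hM : ∀ x, |f x| ≤ M) (x : ℝ) : Integrable fun w => f w * K (w - x) :=
  (hK.integrable.comp_sub_right x).bdd_mul (c := M) hf.aestronglyMeasurable (ae_of_all _ hM)

/-- The variable sits only in the kernel, so `f` need not be differentiable. The sign convention `K'
= -dK/dz` makes the `x`-derivative of `K (w - x)` equal to `K' (w - x)`; iterating from the normal
density then yields Hermite polynomials times the density, without alternating signs. -/
theorem hasDerivAt_integral_mul_kernel {K K' : ℝ → ℝ} (hK : GaussDecay K) (hK' : GaussDecay K')
    (hd : ∀ z, HasDerivAt K (-K' z) z) {f : ℝ → ℝ} (hf : Measurable f)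
    {M : ℝ} (hM : ∀ x, |f x| ≤ M) (x₀ : ℝ) :
    HasDerivAt (fun x => ∫ w, f w * K (w - x)) (∫ w, f w * K' (w - x₀)) x₀ := by
  obtain ⟨hc', C, hC⟩ := hK'
  have hM0 : 0 ≤ M := (abs_nonneg _).trans (hM 0)
  have hC0 : 0 ≤ C := by simpa using (abs_nonneg _).trans (hC 0)
  refine (hasDerivAt_integral_of_dominated_loc_of_deriv_le
    (F' := fun x w => f w * K' (w - x))
    (bound := fun w => M * (C * Real.exp (1 / 4)) * Real.exp (-(w - x₀) ^ 2 / 8))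
    (Metric.ball_mem_nhds x₀ one_pos) ?_ (hK.integrable_mul hf hM x₀) ?_ ?_ ?_ ?_).2
  · exact Filter.Eventually.of_forall fun x => (hK.integrable_mul hf hM x).aestronglyMeasurable
  · exact (hf.mul (hc'.measurable.comp (measurable_id.sub_const x₀))).aestronglyMeasurable
  · refine ae_of_all _ fun w x hx => ?_
    rw [Metric.mem_ball, Real.dist_eq] at hx
    have hx2 : (x - x₀) ^ 2 ≤ 1 := by
      rw [← sq_abs]; nlinarith [abs_nonneg (x - x₀)]
    rw [norm_mul, Real.norm_eq_abs, Real.norm_eq_abs, mul_assoc, mul_assoc, ← Real.exp_add]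
    refine mul_le_mul (hM w) ((hC _).trans ?_) (abs_nonneg _) hM0
    refine mul_le_mul_of_nonneg_left (Real.exp_le_exp.2 ?_) hC0
    -- With `a = w - x₀` and `h = x - x₀`, `|h| ≤ 1`: `(a - h)² ≥ a²/2 - h²`, which explains the
    -- factor `exp (1/4)` and the weaker rate `1/8`.
    nlinarith [sq_nonneg (w - x₀ - 2 * (x - x₀))]
  · exact (integrable_exp_neg_sq_div (by norm_num) x₀).const_mul _
  · refine ae_of_all _ fun w x _ => ?_
    have h := ((hd (w - x)).comp x ((hasDerivAt_id x).const_sub w)).const_mul (f w)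
    simpa [Function.comp_def] using h

/-- Bounded functions on the line with Lipschitz constant `L`. -/
def BddLip (L : ℝ) (f : ℝ → ℝ) : Prop :=
  (∃ M, ∀ x, |f x| ≤ M) ∧ ∀ x y, |f x - f y| ≤ L * |x - y|

theorem BddLip.continuous {L : ℝ} {f : ℝ → ℝ} (hf : BddLip L f) : Continuous f := by
  refine (LipschitzWith.of_dist_le_mul (K := L.toNNReal) fun x y => ?_).continuous
  rw [Real.dist_eq, Real.dist_eq]
  refine (hf.2 x y).trans ?_
  gcongr
  exact Real.le_coe_toNNReal L

theorem BddLip.integrable {L : ℝ} {f : ℝ → ℝ} (hf : BddLip L f) (P : Measure ℝ)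
    [IsFiniteMeasure P] : Integrable f P := by
  obtain ⟨M, hM⟩ := hf.1
  exact Integrable.of_bound hf.continuous.aestronglyMeasurable M (ae_of_all _ hM)

theorem BddLip.comp_affine {L : ℝ} {f : ℝ → ℝ} (hf : BddLip L f) (a b : ℝ) :
    BddLip (L * |a|) (fun x => f (a * x + b)) := by
  obtain ⟨⟨M, hM⟩, h⟩ := hf
  refine ⟨⟨M, fun x => hM _⟩, fun x y => (h _ _).trans_eq ?_⟩
  rw [mul_assoc, ← abs_mul]
  congr 2
  ring

theorem BddLip.const_mul {L : ℝ} {f : ℝ → ℝ} (hf : BddLip L f) (a : ℝ) :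
    BddLip (|a| * L) (fun x => a * f x) := by
  obtain ⟨⟨M, hM⟩, h⟩ := hf
  refine ⟨⟨|a| * M, fun x => ?_⟩, fun x y => ?_⟩
  · rw [abs_mul]; gcongr; exact hM x
  · rw [← mul_sub, abs_mul, mul_assoc]; gcongr; exact h x y

/-- Translating the integration variable moves the increment from the kernel to `f`, so the
Lipschitz constant is the `L¹` norm of the kernel. -/
theorem abs_sub_le_of_integral_mul_kernel {K : ℝ → ℝ} (hK : GaussDecay K) {f : ℝ → ℝ}
    (hf : BddLip 1 f) (x y : ℝ) :
    |(∫ w, f w * K (w - x)) - ∫ w, f w * K (w - y)| ≤ (∫ z, |K z|) * |x - y| := by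
  obtain ⟨M, hM⟩ := hf.1
  have shift : ∀ x, ∫ w, f w * K (w - x) = ∫ z, f (z + x) * K z := fun x => by
    rw [← integral_add_right_eq_self _ x]
    simp
  have hint : ∀ x, Integrable fun z => f (z + x) * K z := fun x => by
    simpa using (hK.integrable_mul hf.continuous.measurable hM x).comp_add_right x
  rw [shift, shift, ← integral_sub (hint x) (hint y), ← integral_mul_const, ← Real.norm_eq_abs]
  refine norm_integral_le_of_norm_le (hK.integrable.abs.mul_const _) (ae_of_all _ fun z => ?_)
  rw [← sub_mul, norm_mul, Real.norm_eq_abs, Real.norm_eq_abs, mul_comm]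
  refine mul_le_mul_of_nonneg_left ?_ (abs_nonneg _)
  have h := hf.2 (z + x) (z + y)
  rwa [one_mul, add_sub_add_left_eq_sub] at h

/-! ### The derivatives of the standard normal density -/

/-- The standard normal density. -/
def stdPdf (z : ℝ) : ℝ := Real.exp (-z ^ 2 / 2) / √(2 * Real.pi)

theorem stdPdf_nonneg (z : ℝ) : 0 ≤ stdPdf z := by
  unfold stdPdf
  positivity

theorem stdPdf_abs (z : ℝ) : stdPdf |z| = stdPdf z := by
  simp [stdPdf]

theorem hasDerivAt_mul_stdPdf {p : ℝ → ℝ} {p' z : ℝ} (hp : HasDerivAt p p' z) :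
    HasDerivAt (fun z => p z * stdPdf z) ((p' - z * p z) * stdPdf z) z := by
  have h1 : HasDerivAt (fun z : ℝ => -z ^ 2 / 2) (-z) z := by
    have := ((hasDerivAt_pow 2 z).neg).div_const 2
    exact this.congr_deriv (by norm_num; ring)
  have h2 := hp.mul (h1.exp.div_const √(2 * Real.pi))
  refine h2.congr_deriv ?_
  simp only [stdPdf]
  ring

theorem gaussDecay_mul_stdPdf {p : ℝ → ℝ} (hp : Continuous p) {C : ℝ}
    (hC : ∀ z, |p z| ≤ C * (1 + z ^ 2 / 8) ^ 2) : GaussDecay fun z => p z * stdPdf z := by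
  have hs : Continuous stdPdf := by unfold stdPdf; fun_prop
  have hC0 : 0 ≤ C := by simpa using (abs_nonneg _).trans (hC 0)
  refine ⟨hp.mul hs, C / √(2 * Real.pi), fun z => ?_⟩
  have h1 : (1 + z ^ 2 / 8) ^ 2 ≤ Real.exp (z ^ 2 / 4) := by
    have : Real.exp (z ^ 2 / 4) = Real.exp (z ^ 2 / 8) ^ 2 := by
      rw [← Real.exp_nat_mul]; congr 1; push_cast; ring
    rw [this]
    have := Real.add_one_le_exp (z ^ 2 / 8)
    gcongr
    linarith
  have h2 : Real.exp (-z ^ 2 / 4) = Real.exp (z ^ 2 / 4) * Real.exp (-z ^ 2 / 2) := by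
    rw [← Real.exp_add]; congr 1; ring
  rw [abs_mul, stdPdf, abs_of_nonneg (a := _ / _) (by positivity), h2]
  calc |p z| * (Real.exp (-z ^ 2 / 2) / √(2 * Real.pi))
      ≤ C * Real.exp (z ^ 2 / 4) * (Real.exp (-z ^ 2 / 2) / √(2 * Real.pi)) := by
        gcongr
        exact (hC z).trans (by gcongr)
    _ = _ := by ring

theorem gaussDecay_stdPdf : GaussDecay fun z => 1 * stdPdf z :=
  gaussDecay_mul_stdPdf (C := 1) continuous_const fun z => by
    rw [abs_one]; nlinarith [sq_nonneg z]

theorem gaussDecay_stdPdf_first : GaussDecay fun z => z * stdPdf z :=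
  gaussDecay_mul_stdPdf (p := fun z => z) (C := 4) continuous_id fun z => by
    rw [abs_le]; constructor <;> nlinarith [sq_nonneg (z - 1), sq_nonneg (z + 1), sq_nonneg z]

theorem gaussDecay_stdPdf_second : GaussDecay fun z => (z ^ 2 - 1) * stdPdf z :=
  gaussDecay_mul_stdPdf (C := 8) (by fun_prop) fun z => by
    rw [abs_le]; constructor <;> nlinarith [sq_nonneg z]

theorem gaussDecay_stdPdf_third : GaussDecay fun z => (z ^ 3 - 3 * z) * stdPdf z :=
  gaussDecay_mul_stdPdf (C := 64) (by fun_prop) fun z => by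
    rw [abs_le]
    constructor <;>
      nlinarith [sq_nonneg z, sq_nonneg (z ^ 2 - z), sq_nonneg (z ^ 2 + z), sq_nonneg (z - 1),
        sq_nonneg (z + 1)]

open Filter Topology in
theorem GaussDecay.tendsto_atTop {K : ℝ → ℝ} (hK : GaussDecay K) : Tendsto K atTop (𝓝 0) := by
  obtain ⟨-, C, hC⟩ := hK
  have h1 : Tendsto (fun z : ℝ => C * Real.exp (-z ^ 2 / 4)) atTop (𝓝 (C * 0)) := by
    refine (Real.tendsto_exp_atBot.comp ?_).const_mul C
    have : Tendsto (fun z : ℝ => z ^ 2 / 4) atTop atTop :=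
      (tendsto_pow_atTop two_ne_zero).atTop_div_const (by norm_num)
    refine (tendsto_neg_atTop_atBot.comp this).congr fun z => ?_
    simp only [Function.comp]; ring
  rw [mul_zero] at h1
  exact squeeze_zero_norm hC h1

theorem integral_abs_stdPdf_first : ∫ z, |z * stdPdf z| = 2 / √(2 * Real.pi) := by
  have h : ∀ z, |z * stdPdf z| = (fun t => t * stdPdf t) |z| := fun z => by
    simp [stdPdf_abs, abs_mul, abs_of_nonneg (stdPdf_nonneg z)]
  simp_rw [h]
  rw [integral_comp_abs (f := fun t => t * stdPdf t)]
  have hd : ∀ z ∈ Ici (0 : ℝ), HasDerivAt (fun z => -(1 * stdPdf z)) (z * stdPdf z) z := fun z _ => by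
    refine (hasDerivAt_mul_stdPdf (hasDerivAt_const z 1)).neg.congr_deriv ?_
    ring
  rw [integral_Ioi_of_hasDerivAt_of_tendsto' hd gaussDecay_stdPdf_first.integrable.integrableOn
    gaussDecay_stdPdf.tendsto_atTop.neg]
  simp [stdPdf]
  ring

/-- The integrand is even and changes sign on the half-line only at `1`; up to sign `z * stdPdf z`
is a primitive. The third-order integral works the same way, with sign change at `√3` and primitive
`(z² - 1) * stdPdf z`. -/
theorem integral_abs_stdPdf_second :
    ∫ z, |(z ^ 2 - 1) * stdPdf z| = 4 * Real.exp (-1 / 2) / √(2 * Real.pi) := by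
  have h : ∀ z, |(z ^ 2 - 1) * stdPdf z| = (fun t => |t ^ 2 - 1| * stdPdf t) |z| := fun z => by
    simp [stdPdf_abs, abs_mul, abs_of_nonneg (stdPdf_nonneg z)]
  simp_rw [h]
  rw [integral_comp_abs (f := fun t => |t ^ 2 - 1| * stdPdf t)]
  have hint : Integrable fun t => |t ^ 2 - 1| * stdPdf t :=
    gaussDecay_stdPdf_second.integrable.abs.congr (ae_of_all _ fun t => by
      simp [abs_mul, abs_of_nonneg (stdPdf_nonneg t)])
  have hd : ∀ z, HasDerivAt (fun z => z * stdPdf z) ((1 - z ^ 2) * stdPdf z) z := fun z => by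
    refine (hasDerivAt_mul_stdPdf (hasDerivAt_id z)).congr_deriv ?_
    simp only [id]; ring
  have hc : Continuous fun z => (1 - z ^ 2) * stdPdf z := by
    have := gaussDecay_stdPdf_second.1.neg
    refine this.congr fun z => ?_
    simp only [Pi.neg_apply]; ring
  rw [← Ioc_union_Ioi_eq_Ioi zero_le_one,
    setIntegral_union (Ioc_disjoint_Ioi le_rfl) measurableSet_Ioi hint.integrableOn
      hint.integrableOn,
    setIntegral_congr_fun (g := fun z => (1 - z ^ 2) * stdPdf z) measurableSet_Ioc
      (fun z hz => by
        simp only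
        rw [abs_of_nonpos (by nlinarith [hz.1, hz.2])]; ring),
    setIntegral_congr_fun (s := Ioi 1) (g := fun z => (z ^ 2 - 1) * stdPdf z) measurableSet_Ioi
      (fun z hz => by
        simp only
        rw [abs_of_nonneg (by nlinarith [mem_Ioi.1 hz])]),
    ← intervalIntegral.integral_of_le zero_le_one,
    intervalIntegral.integral_eq_sub_of_hasDerivAt (fun z _ => hd z) (hc.intervalIntegrable _ _),
    integral_Ioi_of_hasDerivAt_of_tendsto' (f := fun z => -(z * stdPdf z))
      (fun z _ => (hd z).neg.congr_deriv (by ring))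
      gaussDecay_stdPdf_second.integrable.integrableOn
      gaussDecay_stdPdf_first.tendsto_atTop.neg]
  simp [stdPdf]
  ring

theorem integral_abs_stdPdf_third :
    ∫ z, |(z ^ 3 - 3 * z) * stdPdf z| = (2 + 8 * Real.exp (-3 / 2)) / √(2 * Real.pi) := by
  have h : ∀ z, |(z ^ 3 - 3 * z) * stdPdf z| = (fun t => |t ^ 3 - 3 * t| * stdPdf t) |z| :=
    fun z => by
      have e : ∀ t : ℝ, |t ^ 3 - 3 * t| = |t| * |t ^ 2 - 3| := fun t => by
        rw [← abs_mul]; congr 1; ring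
      simp [stdPdf_abs, abs_mul, e, abs_of_nonneg (stdPdf_nonneg z)]
  simp_rw [h]
  rw [integral_comp_abs (f := fun t => |t ^ 3 - 3 * t| * stdPdf t)]
  have hint : Integrable fun t => |t ^ 3 - 3 * t| * stdPdf t :=
    gaussDecay_stdPdf_third.integrable.abs.congr (ae_of_all _ fun t => by
      simp [abs_mul, abs_of_nonneg (stdPdf_nonneg t)])
  have hd : ∀ z, HasDerivAt (fun z => (z ^ 2 - 1) * stdPdf z) ((3 * z - z ^ 3) * stdPdf z) z :=
    fun z => by
      refine (hasDerivAt_mul_stdPdf ((hasDerivAt_pow 2 z).sub_const 1)).congr_deriv ?_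
      push_cast; ring
  have hc : Continuous fun z => (3 * z - z ^ 3) * stdPdf z := by
    have := gaussDecay_stdPdf_third.1.neg
    refine this.congr fun z => ?_
    simp only [Pi.neg_apply]; ring
  have h3 : √(3 : ℝ) ^ 2 = 3 := Real.sq_sqrt (by norm_num)
  have h30 : 0 ≤ √(3 : ℝ) := Real.sqrt_nonneg 3
  rw [← Ioc_union_Ioi_eq_Ioi h30,
    setIntegral_union (Ioc_disjoint_Ioi le_rfl) measurableSet_Ioi hint.integrableOn
      hint.integrableOn,
    setIntegral_congr_fun (g := fun z => (3 * z - z ^ 3) * stdPdf z) measurableSet_Ioc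
      (fun z hz => by
        have : z ^ 2 ≤ 3 := by nlinarith [hz.1, hz.2]
        simp only
        rw [abs_of_nonpos (by nlinarith [hz.1, hz.2])]; ring),
    setIntegral_congr_fun (s := Ioi √3) (g := fun z => (z ^ 3 - 3 * z) * stdPdf z)
      measurableSet_Ioi
      (fun z hz => by
        have hz' := mem_Ioi.1 hz
        have : 3 ≤ z ^ 2 := by nlinarith
        simp only
        rw [abs_of_nonneg (by nlinarith)]),
    ← intervalIntegral.integral_of_le h30,
    intervalIntegral.integral_eq_sub_of_hasDerivAt (fun z _ => hd z) (hc.intervalIntegrable _ _),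
    integral_Ioi_of_hasDerivAt_of_tendsto' (f := fun z => -((z ^ 2 - 1) * stdPdf z))
      (fun z _ => (hd z).neg.congr_deriv (by ring))
      gaussDecay_stdPdf_third.integrable.integrableOn
      gaussDecay_stdPdf_second.tendsto_atTop.neg]
  simp [stdPdf, h3]
  ring

/-! ### Gaussian smoothing of bounded Lipschitz functions -/

/-- The convolution of `f` with the centred normal law of variance `v`. -/
def gaussSmooth (v : ℝ≥0) (f : ℝ → ℝ) (x : ℝ) : ℝ := ∫ y, f (x + y) ∂(gaussianReal 0 v)

/-- The substitution `w = z + x/σ` moves `x` into the unit-variance kernel. The rescaled function `w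
↦ σ⁻¹ f (σ w)` is again 1-Lipschitz, so all dependence on `σ` becomes explicit powers. -/
theorem gaussSmooth_eq_scaled {f : ℝ → ℝ} (hf : Continuous f) {σ : ℝ≥0} (hσ : σ ≠ 0) (x : ℝ) :
    gaussSmooth (σ ^ 2) f x =
      σ * ∫ w, ((σ : ℝ)⁻¹ * f (σ * w)) * (1 * stdPdf (w - (σ : ℝ)⁻¹ * x)) := by
  have hσ' : (σ : ℝ) ≠ 0 := by exact_mod_cast hσ
  have hmap : gaussianReal 0 (σ ^ 2) = (gaussianReal 0 1).map (fun z => (σ : ℝ) * z) := by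
    rw [gaussianReal_map_const_mul]
    congr 1
    · simp
    · ext; simp
  rw [gaussSmooth, hmap, integral_map (by fun_prop) (by fun_prop),
    integral_gaussianReal_eq_integral_smul one_ne_zero, ← integral_const_mul,
    ← integral_sub_right_eq_self _ ((σ : ℝ)⁻¹ * x)]
  congr 1
  ext w
  have e : x + (σ : ℝ) * (w - (σ : ℝ)⁻¹ * x) = σ * w := by field_simp; ring
  rw [e]
  simp only [gaussianPDFReal, stdPdf, smul_eq_mul, NNReal.coe_one, mul_one, sub_zero, one_mul]
  field_simp

/-- One derivative is always absorbed by the Lipschitz property of `f`. Hence the second derivative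
is bounded by `‖φ'‖₁/σ` with Lipschitz constant `‖φ''‖₁/σ²`, and the third by `‖φ''‖₁/σ²` with
Lipschitz constant `‖φ'''‖₁/σ³`. The oscillation bounds are twice the sup bounds. -/
theorem exists_hasDerivAt_gaussSmooth {f : ℝ → ℝ} (hf : BddLip 1 f) {σ : ℝ≥0} (hσ : σ ≠ 0) :
    ∃ F₁ F₂ F₃ : ℝ → ℝ,
      (∀ x, HasDerivAt (gaussSmooth (σ ^ 2) f) (F₁ x) x) ∧
      (∀ x, HasDerivAt F₁ (F₂ x) x) ∧ (∀ x, HasDerivAt F₂ (F₃ x) x) ∧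
      (∀ x y, |F₂ x - F₂ y| ≤ 4 / √(2 * Real.pi) / σ) ∧
      (∀ x y, |F₂ x - F₂ y| ≤ 4 * Real.exp (-1 / 2) / √(2 * Real.pi) / σ ^ 2 * |x - y|) ∧
      (∀ x y, |F₃ x - F₃ y| ≤ 8 * Real.exp (-1 / 2) / √(2 * Real.pi) / σ ^ 2) ∧
      ∀ x y, |F₃ x - F₃ y| ≤ (2 + 8 * Real.exp (-3 / 2)) / √(2 * Real.pi) / σ ^ 3 * |x - y| := by
  have hσ' : (0 : ℝ) < σ := by exact_mod_cast pos_iff_ne_zero.2 hσ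
  set s : ℝ := (σ : ℝ)⁻¹ with hs
  have hs0 : 0 < s := inv_pos.2 hσ'
  have hsσ : s * σ = 1 := inv_mul_cancel₀ hσ'.ne'
  set g : ℝ → ℝ := fun w => s * f (σ * w) with hg
  have hgL : BddLip 1 g := by
    have := (hf.comp_affine σ 0).const_mul s
    simpa [abs_of_pos hs0, hsσ] using this
  obtain ⟨M, hM⟩ := hgL.1
  have hgm := hgL.continuous.measurable
  have d0 := hasDerivAt_integral_mul_kernel gaussDecay_stdPdf gaussDecay_stdPdf_first
    (fun z => (hasDerivAt_mul_stdPdf (hasDerivAt_const z 1)).congr_deriv (by ring)) hgm hM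
  have d1 := hasDerivAt_integral_mul_kernel gaussDecay_stdPdf_first gaussDecay_stdPdf_second
    (fun z => (hasDerivAt_mul_stdPdf (hasDerivAt_id z)).congr_deriv (by simp only [id]; ring))
    hgm hM
  have d2 := hasDerivAt_integral_mul_kernel gaussDecay_stdPdf_second gaussDecay_stdPdf_third
    (fun z => (hasDerivAt_mul_stdPdf ((hasDerivAt_pow 2 z).sub_const 1)).congr_deriv
      (by push_cast; ring)) hgm hM
  have l1 := abs_sub_le_of_integral_mul_kernel gaussDecay_stdPdf_first hgL
  have l2 := abs_sub_le_of_integral_mul_kernel gaussDecay_stdPdf_second hgL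
  have l3 := abs_sub_le_of_integral_mul_kernel gaussDecay_stdPdf_third hgL
  rw [integral_abs_stdPdf_first] at l1
  rw [integral_abs_stdPdf_second] at l2
  rw [integral_abs_stdPdf_third] at l3
  set U₁ : ℝ → ℝ := fun x => ∫ w, g w * ((w - x) * stdPdf (w - x))
  set U₂ : ℝ → ℝ := fun x => ∫ w, g w * (((w - x) ^ 2 - 1) * stdPdf (w - x))
  set U₃ : ℝ → ℝ := fun x => ∫ w, g w * (((w - x) ^ 3 - 3 * (w - x)) * stdPdf (w - x))
  -- A Lipschitz constant bounds the derivative: this is how `U₂` and `U₃` inherit sup bounds from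
  -- `U₁` and `U₂`.
  have bound_of_lip : ∀ {U U' : ℝ → ℝ} {L : ℝ}, 0 ≤ L → (∀ x, HasDerivAt U (U' x) x) →
      (∀ x y, |U x - U y| ≤ L * |x - y|) → ∀ x, |U' x| ≤ L := by
    intro U U' L hL hd hl x
    have hlip : LipschitzWith L.toNNReal U := LipschitzWith.of_dist_le_mul fun x y => by
      rw [Real.dist_eq, Real.dist_eq, Real.coe_toNNReal _ hL]; exact hl x y
    have := norm_deriv_le_of_lipschitz (x₀ := x) hlip
    rwa [(hd x).deriv, Real.norm_eq_abs, Real.coe_toNNReal _ hL] at this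
  have b2 := bound_of_lip (by positivity) d1 l1
  have b3 := bound_of_lip (by positivity) d2 l2
  have hlin : ∀ x : ℝ, HasDerivAt (fun x => s * x) s x := fun x => by
    simpa using (hasDerivAt_id x).const_mul s
  have hscale : ∀ x y : ℝ, |s * x - s * y| = s * |x - y| := fun x y => by
    rw [← mul_sub, abs_mul, abs_of_pos hs0]
  refine ⟨fun x => U₁ (s * x), fun x => s * U₂ (s * x), fun x => s ^ 2 * U₃ (s * x),
    fun x => ?_, fun x => ?_, fun x => ?_, fun x y => ?_, fun x y => ?_, fun x y => ?_,
    fun x y => ?_⟩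
  · have h := ((d0 (s * x)).comp x (hlin x)).const_mul (σ : ℝ)
    refine (h.congr_deriv ?_).congr_of_eventuallyEq (Filter.Eventually.of_forall fun y => ?_)
    · rw [mul_comm, mul_assoc, hsσ, mul_one]
    · exact gaussSmooth_eq_scaled hf.continuous hσ y
  · exact ((d1 (s * x)).comp x (hlin x)).congr_deriv (mul_comm _ _)
  · exact (((d2 (s * x)).comp x (hlin x)).const_mul s).congr_deriv (by ring)
  · rw [← mul_sub, abs_mul, abs_of_pos hs0]
    calc s * |U₂ (s * x) - U₂ (s * y)| ≤ s * (2 / √(2 * Real.pi) + 2 / √(2 * Real.pi)) := by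
          gcongr
          exact (abs_sub _ _).trans (add_le_add (b2 _) (b2 _))
      _ = _ := by rw [hs]; ring
  · rw [← mul_sub, abs_mul, abs_of_pos hs0]
    calc s * |U₂ (s * x) - U₂ (s * y)| ≤ s * (_ * |s * x - s * y|) := by
          gcongr
          exact l2 _ _
      _ = _ := by rw [hscale, hs]; ring
  · rw [← mul_sub, abs_mul, abs_of_pos (pow_pos hs0 2)]
    calc s ^ 2 * |U₃ (s * x) - U₃ (s * y)| ≤ s ^ 2 *
          (4 * Real.exp (-1 / 2) / √(2 * Real.pi) + 4 * Real.exp (-1 / 2) / √(2 * Real.pi)) := by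
          gcongr
          exact (abs_sub _ _).trans (add_le_add (b3 _) (b3 _))
      _ = _ := by rw [hs]; ring
  · rw [← mul_sub, abs_mul, abs_of_pos (pow_pos hs0 2)]
    calc s ^ 2 * |U₃ (s * x) - U₃ (s * y)| ≤ s ^ 2 * (_ * |s * x - s * y|) := by
          gcongr
          exact l3 _ _
      _ = _ := by rw [hscale, hs]; ring

/-! ### Integrals against convolutions -/

theorem BddLip.comp_const_add {L : ℝ} {f : ℝ → ℝ} (hf : BddLip L f) (x : ℝ) :
    BddLip L (fun y => f (x + y)) := by
  simpa [add_comm] using hf.comp_affine 1 x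

theorem abs_integral_le_of_abs_le {f : ℝ → ℝ} {C : ℝ} (P : Measure ℝ) [IsProbabilityMeasure P]
    (h : ∀ x, |f x| ≤ C) : |∫ x, f x ∂P| ≤ C := by
  simpa using norm_integral_le_of_norm_le_const (μ := P) (f := f) (ae_of_all _ h)

theorem BddLip.integral_add {L : ℝ} {f : ℝ → ℝ} (hf : BddLip L f) (P : Measure ℝ)
    [IsProbabilityMeasure P] : BddLip L (fun x => ∫ y, f (x + y) ∂P) := by
  obtain ⟨M, hM⟩ := hf.1
  refine ⟨⟨M, fun x => ?_⟩, fun x x' => ?_⟩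
  · exact abs_integral_le_of_abs_le P fun y => hM (x + y)
  · rw [← integral_sub ((hf.comp_const_add x).integrable P) ((hf.comp_const_add x').integrable P)]
    exact abs_integral_le_of_abs_le P fun y => by simpa using hf.2 (x + y) (x' + y)

theorem BddLip.gaussSmooth {L : ℝ} {f : ℝ → ℝ} (hf : BddLip L f) (v : ℝ≥0) :
    BddLip L (gaussSmooth v f) :=
  hf.integral_add _

theorem BddLip.integral_conv {L : ℝ} {f : ℝ → ℝ} (hf : BddLip L f) (P Q : Measure ℝ)
    [IsProbabilityMeasure P] [IsProbabilityMeasure Q] :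
    ∫ x, f x ∂(P.conv Q) = ∫ x, ∫ y, f (x + y) ∂Q ∂P :=
  MeasureTheory.integral_conv (hf.integrable _)

theorem BddLip.integral_integral_comm {L : ℝ} {f : ℝ → ℝ} (hf : BddLip L f) (P Q : Measure ℝ)
    [IsProbabilityMeasure P] [IsProbabilityMeasure Q] :
    ∫ x, ∫ y, f (x + y) ∂Q ∂P = ∫ x, ∫ y, f (x + y) ∂P ∂Q := by
  rw [← hf.integral_conv, ← hf.integral_conv, Measure.conv_comm]

theorem gaussSmooth_gaussSmooth {L : ℝ} {f : ℝ → ℝ} (hf : BddLip L f) (v w : ℝ≥0) :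
    gaussSmooth w (gaussSmooth v f) = gaussSmooth (v + w) f := by
  ext x
  have h := (hf.comp_const_add x).integral_conv (gaussianReal 0 w) (gaussianReal 0 v)
  rw [gaussianReal_conv_gaussianReal, add_zero, add_comm w v] at h
  simp only [gaussSmooth, h, add_assoc]

/-! ### Differences of laws integrated against Lipschitz functions -/

/-- The law `P - Q` integrates `1`-Lipschitz bounded functions to values of modulus at most `K`. -/
def LipDiffLE (P Q : Measure ℝ) (K : ℝ) : Prop :=
  ∀ f, BddLip 1 f → |∫ x, f x ∂P - ∫ x, f x ∂Q| ≤ K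

theorem LipDiffLE.nonneg {P Q : Measure ℝ} {K : ℝ} (h : LipDiffLE P Q K) : 0 ≤ K :=
  (abs_nonneg _).trans (h (fun _ => 0) ⟨⟨0, by simp⟩, by simp⟩)

theorem LipDiffLE.mono {P Q : Measure ℝ} {K K' : ℝ} (h : LipDiffLE P Q K) (hK : K ≤ K') :
    LipDiffLE P Q K' :=
  fun f hf => (h f hf).trans hK

theorem LipDiffLE.abs_integral_sub_le {P Q : Measure ℝ} [IsProbabilityMeasure P]
    [IsProbabilityMeasure Q] {K L : ℝ} (h : LipDiffLE P Q K) (hL : 0 ≤ L) {f : ℝ → ℝ}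
    (hf : BddLip L f) : |∫ x, f x ∂P - ∫ x, f x ∂Q| ≤ L * K := by
  rcases hL.eq_or_lt with rfl | hL
  · have hc : ∀ x, f x = f 0 := fun x => by
      have := hf.2 x 0
      rw [zero_mul] at this
      exact sub_eq_zero.1 (abs_nonpos_iff.1 this)
    simp_rw [hc]
    simp
  · have hg : BddLip 1 (fun x => L⁻¹ * f x) := by
      have := hf.const_mul L⁻¹
      rwa [abs_of_pos (inv_pos.2 hL), inv_mul_cancel₀ hL.ne'] at this
    have := h _ hg
    rw [integral_const_mul, integral_const_mul, ← mul_sub, abs_mul,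
      abs_of_pos (inv_pos.2 hL), inv_mul_le_iff₀ hL] at this
    exact this

theorem integral_abs_gaussianReal (σ : ℝ≥0) :
    ∫ y, |y| ∂(gaussianReal 0 (σ ^ 2)) = σ * (2 / √(2 * Real.pi)) := by
  have hmap : gaussianReal 0 (σ ^ 2) = (gaussianReal 0 1).map (fun z => (σ : ℝ) * z) := by
    rw [gaussianReal_map_const_mul]
    congr 1
    · simp
    · ext; simp
  rw [hmap, integral_map (by fun_prop) (by fun_prop),
    integral_gaussianReal_eq_integral_smul one_ne_zero, ← integral_abs_stdPdf_first,
    ← integral_const_mul]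
  congr 1
  ext z
  rw [abs_mul, abs_mul, abs_of_nonneg (stdPdf_nonneg z), NNReal.abs_eq]
  simp only [gaussianPDFReal, stdPdf, smul_eq_mul, NNReal.coe_one, mul_one, sub_zero]
  field_simp

theorem abs_sub_gaussSmooth_le {f : ℝ → ℝ} (hf : BddLip 1 f) (σ : ℝ≥0) (x : ℝ) :
    |f x - gaussSmooth (σ ^ 2) f x| ≤ σ * (2 / √(2 * Real.pi)) := by
  have hint : Integrable (fun y : ℝ => |y|) (gaussianReal 0 (σ ^ 2)) :=
    ((memLp_id_gaussianReal 1).integrable (by simp)).abs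
  have h : f x - gaussSmooth (σ ^ 2) f x = ∫ y, (f x - f (x + y)) ∂(gaussianReal 0 (σ ^ 2)) := by
    rw [integral_sub (integrable_const _) ((hf.comp_const_add x).integrable _)]
    simp [gaussSmooth]
  rw [h, ← integral_abs_gaussianReal]
  rw [← Real.norm_eq_abs]
  refine norm_integral_le_of_norm_le hint (ae_of_all _ fun y => ?_)
  simpa using hf.2 x (x + y)

theorem abs_integral_sub_gaussSmooth_le {f : ℝ → ℝ} (hf : BddLip 1 f) (σ : ℝ≥0) (P : Measure ℝ)
    [IsProbabilityMeasure P] :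
    |∫ x, f x ∂P - ∫ x, gaussSmooth (σ ^ 2) f x ∂P| ≤ σ * (2 / √(2 * Real.pi)) := by
  rw [← integral_sub (hf.integrable P) ((hf.gaussSmooth _).integrable P)]
  exact abs_integral_le_of_abs_le P fun x => abs_sub_gaussSmooth_le hf σ x

/-- Smoothing moves `f` by at most the mean absolute value `2σ/√(2π)` of `N_{σ²}`. This is paid once
for each of the two laws, hence `betaC = 4/√(2π)`. -/
theorem LipDiffLE.of_gaussSmooth {P Q : Measure ℝ} [IsProbabilityMeasure P]
    [IsProbabilityMeasure Q] {K : ℝ} (σ : ℝ≥0)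
    (h : ∀ f, BddLip 1 f →
      |∫ x, gaussSmooth (σ ^ 2) f x ∂P - ∫ x, gaussSmooth (σ ^ 2) f x ∂Q| ≤ K) :
    LipDiffLE P Q (K + betaC * σ) := by
  intro f hf
  have h1 := abs_le.1 (h f hf)
  have h2 := abs_le.1 (abs_integral_sub_gaussSmooth_le hf σ P)
  have h3 := abs_le.1 (abs_integral_sub_gaussSmooth_le hf σ Q)
  have e : betaC * σ = σ * (2 / √(2 * Real.pi)) + σ * (2 / √(2 * Real.pi)) := by
    unfold betaC; ring
  rw [e, abs_le]
  constructor <;> linarith [h1.1, h1.2, h2.1, h2.2, h3.1, h3.2]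

/-! ### The second order enorm -/

theorem mem_testFun_two {g f f₁ f₂ : ℝ → ℝ} (hb : ∃ C, ∀ x, |f x| ≤ C)
    (h₁ : ∀ x, HasDerivAt f (f₁ x) x) (h₂ : ∀ x, HasDerivAt f₁ (f₂ x) x)
    (hg : ∀ x y, |f₂ x - f₂ y| ≤ g |x - y|) : f ∈ testFun 2 g := by
  have e₁ : deriv f = f₁ := funext fun x => (h₁ x).deriv
  have e₂ : deriv f₁ = f₂ := funext fun x => (h₂ x).deriv
  have d₀ : Differentiable ℝ f := fun x => (h₁ x).differentiableAt
  refine ⟨d₀.continuous.measurable, hb, fun k hk => ?_, ?_⟩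
  · interval_cases k
    · simpa using d₀
    · rw [iteratedDeriv_one, e₁]
      exact fun x => (h₂ x).differentiableAt
  · rw [iteratedDeriv_succ, iteratedDeriv_one, e₁, e₂]
    exact hg

/-- The law `P - Q` integrates the test functions of `ζ_{2,δ}` to values of modulus at most `ζ`. -/
def SmoothDiffLE (δ : ℝ) (P Q : Measure ℝ) (ζ : ℝ) : Prop :=
  ∀ f ∈ testFun 2 (fun u => min u (u ^ δ)), |∫ x, f x ∂P - ∫ x, f x ∂Q| ≤ ζ

theorem SmoothDiffLE.nonneg {δ : ℝ} {P Q : Measure ℝ} {ζ : ℝ} (h : SmoothDiffLE δ P Q ζ) :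
    0 ≤ ζ :=
  (abs_nonneg _).trans <| h (fun _ => 0) <| mem_testFun_two (f₁ := fun _ => 0) (f₂ := fun _ => 0)
    ⟨0, by simp⟩ (fun _ => hasDerivAt_const _ _) (fun _ => hasDerivAt_const _ _)
    fun x y => by simp only [sub_self, abs_zero]; positivity

theorem SmoothDiffLE.abs_integral_sub_le {δ : ℝ} {P Q : Measure ℝ} {ζ C : ℝ}
    (h : SmoothDiffLE δ P Q ζ) (hC : 0 < C) {f f₁ f₂ : ℝ → ℝ} (hb : ∃ M, ∀ x, |f x| ≤ M)
    (h₁ : ∀ x, HasDerivAt f (f₁ x) x) (h₂ : ∀ x, HasDerivAt f₁ (f₂ x) x)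
    (hg : ∀ x y, |f₂ x - f₂ y| ≤ C * min |x - y| (|x - y| ^ δ)) :
    |∫ x, f x ∂P - ∫ x, f x ∂Q| ≤ C * ζ := by
  obtain ⟨M, hM⟩ := hb
  have hC' := inv_pos.2 hC
  have := h (fun x => C⁻¹ * f x) <| mem_testFun_two
    ⟨C⁻¹ * M, fun x => by rw [abs_mul, abs_of_pos hC']; gcongr; exact hM x⟩
    (fun x => (h₁ x).const_mul _) (fun x => (h₂ x).const_mul _)
    fun x y => by
      rw [← mul_sub, abs_mul, abs_of_pos hC', inv_mul_le_iff₀ hC]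
      exact hg x y
  rwa [integral_const_mul, integral_const_mul, ← mul_sub, abs_mul, abs_of_pos hC',
    inv_mul_le_iff₀ hC] at this

theorem div_rpow_mul_div_rpow {a b s δ : ℝ} (ha : 0 ≤ a) (hb : 0 ≤ b) (hs : 0 < s) (k : ℕ) :
    (a / s ^ k) ^ (1 - δ) * (b / s ^ (k + 1)) ^ δ =
      a ^ (1 - δ) * b ^ δ * (s ^ 2) ^ (-(k + δ) / 2 : ℝ) := by
  rw [Real.div_rpow ha (by positivity), Real.div_rpow hb (by positivity),
    ← Real.rpow_natCast s k, ← Real.rpow_natCast s (k + 1), ← Real.rpow_natCast s 2,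
    ← Real.rpow_mul hs.le, ← Real.rpow_mul hs.le, ← Real.rpow_mul hs.le, div_mul_div_comm,
    ← Real.rpow_add hs, div_eq_mul_inv, ← Real.rpow_neg hs.le]
  congr 2
  push_cast
  ring

section Gaussian

variable {δ : ℝ} {Q : Measure ℝ} {ζ : ℝ}

theorem SmoothDiffLE.abs_integral_gaussSmooth_le [IsProbabilityMeasure Q]
    (h : SmoothDiffLE δ Q (gaussianReal 0 1) ζ) (hδ : δ ∈ Icc (0 : ℝ) 1) {f : ℝ → ℝ}
    (hf : BddLip 1 f) {v : ℝ≥0} (hv : 1 ≤ v) :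
    |∫ x, gaussSmooth v f x ∂Q - ∫ x, gaussSmooth v f x ∂(gaussianReal 0 1)| ≤
      alphaD δ * (v : ℝ) ^ (-(1 + δ) / 2) * ζ := by
  obtain ⟨σ, rfl⟩ : ∃ σ : ℝ≥0, v = σ ^ 2 := ⟨NNReal.sqrt v, by simp⟩
  have hσ1 : (1 : ℝ) ≤ σ := by
    by_contra! hlt
    have : (1 : ℝ) ≤ (σ : ℝ) ^ 2 := by exact_mod_cast hv
    nlinarith [σ.coe_nonneg]
  have hσ0 : (0 : ℝ) < σ := by linarith
  obtain ⟨F₁, F₂, -, d₁, d₂, -, b₁, b₂, -⟩ :=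
    exists_hasDerivAt_gaussSmooth hf (σ := σ) (by exact_mod_cast hσ0.ne')
  have he := half_le_exp_neg_half
  have he' : Real.exp (-1 / 2) ≤ 1 := Real.exp_le_one_iff.2 (by norm_num)
  have hs : 0 < √(2 * Real.pi) := by positivity
  refine h.abs_integral_sub_le (by have := alphaD_pos δ; positivity) (hf.gaussSmooth _).1 d₁ d₂
    fun x y => ?_
  have := le_interpolation_mul_min (D := |F₂ x - F₂ y|)
    (A := (16 * Real.exp (-1 / 2) - 4) / √(2 * Real.pi) / (σ : ℝ) ^ 1)
    (B := 4 * Real.exp (-1 / 2) / √(2 * Real.pi) / (σ : ℝ) ^ (1 + 1)) hδ (abs_nonneg _)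
    (by positivity) (abs_nonneg (x - y)) ?_ ?_ (b₂ x y)
  · rw [div_rpow_mul_div_rpow (div_nonneg (by linarith) hs.le) (by positivity) hσ0] at this
    simpa [alphaD] using this
  · refine div_le_div₀ (div_nonneg (by linarith) hs.le) ?_ (by positivity)
      (pow_le_pow_right₀ hσ1 (by norm_num))
    gcongr
    linarith
  -- The oscillation bound has numerator `4`, which is weakened to `16 * exp (-1/2) - 4` using `exp
  -- (-1/2) ≥ 1/2`.
  · refine (b₁ x y).trans ?_
    rw [pow_one]
    gcongr
    linarith

/-- An increment of this function in `x` is the integral of `F (x + ·) - F (x' + ·)` against `Q -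
N_1`. The mean value theorem bounds the variation of that function's second derivative by `|x - x'|`
times the variation of `F₃`, so the third derivative of `F` decides. The condition `1 ≤ v` ensures
`B ≤ A` in the interpolation. -/
theorem SmoothDiffLE.bddLip_integral_gaussSmooth [IsProbabilityMeasure Q]
    (h : SmoothDiffLE δ Q (gaussianReal 0 1) ζ) (hδ : δ ∈ Icc (0 : ℝ) 1) {f : ℝ → ℝ}
    (hf : BddLip 1 f) {v : ℝ≥0} (hv : 1 ≤ v) :
    BddLip (gammaD δ * (v : ℝ) ^ (-1 - δ / 2) * ζ) fun x =>
      ∫ y, gaussSmooth v f (x + y) ∂Q - ∫ y, gaussSmooth v f (x + y) ∂(gaussianReal 0 1) := by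
  have hF := hf.gaussSmooth v
  refine ⟨?_, fun x x' => ?_⟩
  · obtain ⟨M, hM⟩ := (hF.integral_add Q).1
    obtain ⟨M', hM'⟩ := (hF.integral_add (gaussianReal 0 1)).1
    exact ⟨M + M', fun x => (abs_sub _ _).trans (add_le_add (hM x) (hM' x))⟩
  rcases eq_or_ne x x' with rfl | hne
  · simp
  have hpos : 0 < |x - x'| := abs_pos.2 (sub_ne_zero.2 hne)
  obtain ⟨σ, rfl⟩ : ∃ σ : ℝ≥0, v = σ ^ 2 := ⟨NNReal.sqrt v, by simp⟩
  have hσ1 : (1 : ℝ) ≤ σ := by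
    by_contra! hlt
    have : (1 : ℝ) ≤ (σ : ℝ) ^ 2 := by exact_mod_cast hv
    nlinarith [σ.coe_nonneg]
  have hσ0 : (0 : ℝ) < σ := by linarith
  obtain ⟨F₁, F₂, F₃, d₁, d₂, d₃, -, -, b₁, b₂⟩ :=
    exists_hasDerivAt_gaussSmooth hf (σ := σ) (by exact_mod_cast hσ0.ne')
  have hs : 0 < √(2 * Real.pi) := by positivity
  have hcoef : ∀ x y, |F₃ x - F₃ y| ≤
      gammaD δ * ((σ ^ 2 : ℝ≥0) : ℝ) ^ (-1 - δ / 2) * min |x - y| (|x - y| ^ δ) := fun x y => by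
    have := le_interpolation_mul_min (D := |F₃ x - F₃ y|)
      (A := 8 * Real.exp (-1 / 2) / √(2 * Real.pi) / (σ : ℝ) ^ 2)
      (B := (2 + 8 * Real.exp (-3 / 2)) / √(2 * Real.pi) / (σ : ℝ) ^ (2 + 1)) hδ (abs_nonneg _)
      (by positivity) (abs_nonneg (x - y)) ?_ (b₁ x y) (b₂ x y)
    · rw [div_rpow_mul_div_rpow (by positivity) (by positivity) hσ0] at this
      have e : -1 - δ / 2 = -((2 : ℕ) + δ) / 2 := by push_cast; ring
      rwa [gammaD, e, NNReal.coe_pow]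
    · refine div_le_div₀ (by positivity) ?_ (by positivity) (pow_le_pow_right₀ hσ1 (by norm_num))
      gcongr
      exact norm_third_le_two_mul_norm_second
  set C := gammaD δ * ((σ ^ 2 : ℝ≥0) : ℝ) ^ (-1 - δ / 2) with hCdef
  have hC : 0 < C := by have := gammaD_pos δ; positivity
  set F := gaussSmooth (σ ^ 2) f
  have hsub : ∀ (P : Measure ℝ) [IsProbabilityMeasure P],
      ∫ y, F (x + y) ∂P - ∫ y, F (x' + y) ∂P = ∫ y, (F (x + y) - F (x' + y)) ∂P := fun P _ =>
    (integral_sub ((hF.comp_const_add x).integrable P) ((hF.comp_const_add x').integrable P)).symm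
  rw [sub_sub_sub_comm, hsub, hsub, mul_right_comm]
  have shift : ∀ {G G' : ℝ → ℝ}, (∀ x, HasDerivAt G (G' x) x) → ∀ a y : ℝ,
      HasDerivAt (fun y => G (a + y)) (G' (a + y)) y := fun hG a y => (hG _).comp_const_add a y
  obtain ⟨M, hM⟩ := hF.1
  refine h.abs_integral_sub_le (mul_pos hC hpos)
    ⟨M + M, fun y => (abs_sub _ _).trans (add_le_add (hM _) (hM _))⟩
    (fun y => (shift d₁ x y).sub (shift d₁ x' y)) (fun y => (shift d₂ x y).sub (shift d₂ x' y))
    fun y y' => ?_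
  -- Mean value inequality in the translation parameter `t`, with `y` and `y'` fixed.
  have hmv : ‖(F₂ (x + y) - F₂ (x + y')) - (F₂ (x' + y) - F₂ (x' + y'))‖ ≤
      C * min |y - y'| (|y - y'| ^ δ) * ‖x - x'‖ := by
    refine convex_univ.norm_image_sub_le_of_norm_hasDerivWithin_le
      (f := fun t => F₂ (t + y) - F₂ (t + y')) (f' := fun t => F₃ (t + y) - F₃ (t + y'))
      (fun t _ => (((d₃ _).comp_add_const t y).sub
        ((d₃ _).comp_add_const t y')).hasDerivWithinAt) (fun t _ => ?_) (mem_univ _) (mem_univ _)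
    simpa using hcoef (t + y) (t + y')
  rw [sub_sub_sub_comm, mul_right_comm]
  exact hmv

/-! ### The main estimate -/

/-- Lindeberg telescoping: the `k`-th summand replaces one factor `N_1` by `Q`, with `Q^{*k}`
already in place and the remaining `n - 1 - k` normal factors moved into the smoothing of `f`. -/
theorem integral_conv_gaussSmooth_telescope [IsProbabilityMeasure Q] {f : ℝ → ℝ}
    (hf : BddLip 1 f) (A : ℝ≥0) (n : ℕ) :
    ∫ x, gaussSmooth A f x ∂(convPow Q n) - ∫ x, gaussSmooth A f x ∂(gaussianReal 0 n) =
      ∑ k ∈ Finset.range n, ∫ x, (∫ y, gaussSmooth (A + (n - 1 - k : ℕ)) f (x + y) ∂Q -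
        ∫ y, gaussSmooth (A + (n - 1 - k : ℕ)) f (x + y) ∂(gaussianReal 0 1)) ∂(convPow Q k) := by
  have hstep : ∀ k ∈ Finset.range n,
      ∫ x, (∫ y, gaussSmooth (A + (n - 1 - k : ℕ)) f (x + y) ∂Q -
        ∫ y, gaussSmooth (A + (n - 1 - k : ℕ)) f (x + y) ∂(gaussianReal 0 1)) ∂(convPow Q k) =
      ∫ x, gaussSmooth (A + (n - (k + 1) : ℕ)) f x ∂(convPow Q (k + 1)) -
        ∫ x, gaussSmooth (A + (n - k : ℕ)) f x ∂(convPow Q k) := fun k hk => by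
    have hk' := Finset.mem_range.1 hk
    have hF := hf.gaussSmooth (A + (n - 1 - k : ℕ))
    have e : A + ((n - k : ℕ) : ℝ≥0) = A + ((n - 1 - k : ℕ) : ℝ≥0) + 1 := by
      rw [add_assoc, ← Nat.cast_add_one]
      congr 2
      omega
    rw [integral_sub ((hF.integral_add Q).integrable _) ((hF.integral_add _).integrable _), e,
      ← gaussSmooth_gaussSmooth hf _ 1, show n - (k + 1) = n - 1 - k by omega, convPow,
      hF.integral_conv]
    rfl
  rw [Finset.sum_congr rfl hstep,
    Finset.sum_range_sub (fun k => ∫ x, gaussSmooth (A + (n - k : ℕ)) f x ∂(convPow Q k))]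
  congr 1
  · simp
  · rw [tsub_zero, ← gaussSmooth_gaussSmooth hf, convPow, integral_dirac]
    simp [gaussSmooth]

theorem lipDiffLE_convPow [IsProbabilityMeasure Q] {κ η : ℝ}
    (hκ : LipDiffLE Q (gaussianReal 0 1) κ) (hζ : SmoothDiffLE δ Q (gaussianReal 0 1) ζ)
    (hδ : δ ∈ Icc (0 : ℝ) 1) (hη : 0 < η) (hlt : gammaD δ * gD δ η * ζ < 1) (n : ℕ) :
    LipDiffLE (convPow Q n) (gaussianReal 0 n) ((n : ℝ) ^ ((1 - δ) / 2) *
      ((κ + alphaD δ * ζ + betaC * η) / (1 - gammaD δ * gD δ η * ζ))) := by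
  have hα := alphaD_pos δ
  have hγ := gammaD_pos δ
  have hβ : 0 < betaC := by unfold betaC; positivity
  have hζ0 := hζ.nonneg
  have hκ0 := hκ.nonneg
  set X := (κ + alphaD δ * ζ + betaC * η) / (1 - gammaD δ * gD δ η * ζ) with hX
  have hden : 0 < 1 - gammaD δ * gD δ η * ζ := by linarith
  have hX0 : 0 ≤ X := by positivity
  have hXeq : κ + alphaD δ * ζ + betaC * η + gammaD δ * gD δ η * ζ * X = X := by
    have := div_mul_cancel₀ (κ + alphaD δ * ζ + betaC * η) hden.ne'
    rw [← hX] at this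
    linarith
  induction n using Nat.strong_induction_on with
  | _ n ih =>
  rcases n with - | m
  -- For `n = 0` both laws are the Dirac measure at `0`. The case is needed because the recursion
  -- below calls `k = 0`.
  · intro f hf
    simp only [convPow, Nat.cast_zero, gaussianReal_zero_var, sub_self, abs_zero]
    positivity
  set n : ℝ := (m : ℝ) + 1 with hn
  have hn1 : 1 ≤ n := by have := m.cast_nonneg (α := ℝ); linarith
  have hn0 : 0 ≤ n := by linarith
  set r := n ^ ((1 - δ) / 2) with hr
  have hr1 : 1 ≤ r := Real.one_le_rpow hn1 (by linarith [hδ.2])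
  have hr0 : 0 ≤ r := by linarith
  have hr2 : r ^ 2 = n ^ (1 - δ) := by
    rw [hr, ← Real.rpow_natCast, ← Real.rpow_mul hn0]; congr 1; push_cast; ring
  set ε : ℝ≥0 := ⟨η * r, by positivity⟩ with hε
  have hεr : (ε : ℝ) = η * r := rfl
  have hA : ((ε ^ 2 : ℝ≥0) : ℝ) = η ^ 2 * n ^ (1 - δ) := by
    push_cast; rw [hεr, mul_pow, hr2]
  have main : ∀ f, BddLip 1 f →
      |∫ x, gaussSmooth (ε ^ 2) f x ∂(convPow Q (m + 1)) -
        ∫ x, gaussSmooth (ε ^ 2) f x ∂(gaussianReal 0 (m + 1 : ℕ))| ≤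
      r * (κ + alphaD δ * ζ + gammaD δ * gD δ η * ζ * X) := by
    intro f hf
    rw [integral_conv_gaussSmooth_telescope hf, Finset.sum_range_succ]
    -- For `k = m` the smoothing variance is only `ε²`, which may be below `1`; the smoothed `f` is
    -- still 1-Lipschitz, so `κ` serves as the bound.
    have last : |∫ x, (∫ y, gaussSmooth (ε ^ 2 + (m + 1 - 1 - m : ℕ)) f (x + y) ∂Q -
        ∫ y, gaussSmooth (ε ^ 2 + (m + 1 - 1 - m : ℕ)) f (x + y) ∂(gaussianReal 0 1))
          ∂(convPow Q m)| ≤ κ := by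
      exact abs_integral_le_of_abs_le _ fun x => hκ _
        ((hf.gaussSmooth (ε ^ 2 + (m + 1 - 1 - m : ℕ))).comp_const_add x)
    have term : ∀ k ∈ Finset.range m,
        |∫ x, (∫ y, gaussSmooth (ε ^ 2 + (m + 1 - 1 - k : ℕ)) f (x + y) ∂Q -
          ∫ y, gaussSmooth (ε ^ 2 + (m + 1 - 1 - k : ℕ)) f (x + y) ∂(gaussianReal 0 1))
            ∂(convPow Q k)| ≤
        gammaD δ * ζ * (r * X) *
            (η ^ 2 * n ^ (1 - δ) + ((m - 1 - k : ℕ) + 1 : ℝ)) ^ (-1 - δ / 2) +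
          alphaD δ * ζ * (m : ℝ) ^ (-(1 + δ) / 2) := by
      intro k hk
      have hkm := Finset.mem_range.1 hk
      have hm0 : (0 : ℝ) < m := by exact_mod_cast (by omega : 0 < m)
      have hj : m + 1 - 1 - k = m - 1 - k + 1 := by omega
      set v : ℝ≥0 := ε ^ 2 + (m + 1 - 1 - k : ℕ) with hv
      have hvr : (v : ℝ) = η ^ 2 * n ^ (1 - δ) + ((m - 1 - k : ℕ) + 1 : ℝ) := by
        rw [hv, NNReal.coe_add, hA, hj, NNReal.coe_natCast, Nat.cast_add_one]
      have hv1 : 1 ≤ v := by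
        rw [hv, hj]; push_cast
        exact le_add_left (le_add_left le_rfl)
      have hF := hf.gaussSmooth v
      set H : ℝ → ℝ := fun x => ∫ y, gaussSmooth v f (x + y) ∂Q -
        ∫ y, gaussSmooth v f (x + y) ∂(gaussianReal 0 1)
      have hH : BddLip _ H := hζ.bddLip_integral_gaussSmooth hδ hf hv1
      have t1 := (ih k (by omega)).abs_integral_sub_le (by positivity) hH
      -- By Fubini, averaging `H` over `N_k` adds `k` to the smoothing variance, for a total of at
      -- least `m`.
      have t2 : ∫ x, H x ∂(gaussianReal 0 k) = ∫ x, gaussSmooth (v + k) f x ∂Q -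
          ∫ x, gaussSmooth (v + k) f x ∂(gaussianReal 0 1) := by
        rw [integral_sub ((hF.integral_add Q).integrable _) ((hF.integral_add _).integrable _),
          hF.integral_integral_comm, hF.integral_integral_comm _ (gaussianReal 0 1),
          ← gaussSmooth_gaussSmooth hf v]
        rfl
      have t3 := hζ.abs_integral_gaussSmooth_le hδ hf (v := v + k) (le_add_right hv1)
      rw [← t2] at t3
      have hpow1 : (k : ℝ) ^ ((1 - δ) / 2) ≤ r := by
        refine Real.rpow_le_rpow (by positivity) ?_ (by linarith [hδ.2])
        have : (k : ℝ) ≤ m := by exact_mod_cast hkm.le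
        linarith
      have hpow2 : ((v + k : ℝ≥0) : ℝ) ^ (-(1 + δ) / 2) ≤ (m : ℝ) ^ (-(1 + δ) / 2) := by
        refine Real.rpow_le_rpow_of_nonpos hm0 ?_ (by linarith [hδ.1])
        have hmk : (m : ℝ) = ((m - 1 - k : ℕ) : ℝ) + 1 + k := by
          exact_mod_cast (by omega : m = m - 1 - k + 1 + k)
        have hn' : 0 ≤ η ^ 2 * n ^ (1 - δ) := by positivity
        rw [NNReal.coe_add, hvr, NNReal.coe_natCast]
        linarith
      calc |∫ x, H x ∂(convPow Q k)|
          ≤ |∫ x, H x ∂(convPow Q k) - ∫ x, H x ∂(gaussianReal 0 k)| +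
              |∫ x, H x ∂(gaussianReal 0 k)| := by
            have := abs_add_le (∫ x, H x ∂(convPow Q k) - ∫ x, H x ∂(gaussianReal 0 k))
              (∫ x, H x ∂(gaussianReal 0 k))
            rwa [sub_add_cancel] at this
        _ ≤ gammaD δ * (v : ℝ) ^ (-1 - δ / 2) * ζ * (r * X) +
              alphaD δ * (m : ℝ) ^ (-(1 + δ) / 2) * ζ := by
            refine add_le_add (t1.trans ?_) (t3.trans ?_) <;> gcongr
        _ = _ := by rw [hvr]; ring
    have hsum1 : ∑ k ∈ Finset.range m,
        (η ^ 2 * n ^ (1 - δ) + ((m - 1 - k : ℕ) + 1 : ℝ)) ^ (-1 - δ / 2) ≤ gD δ η := by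
      rw [Finset.sum_range_reflect
        (fun j : ℕ => (η ^ 2 * n ^ (1 - δ) + ((j : ℝ) + 1)) ^ (-1 - δ / 2))]
      exact sum_inv_rpow_le_gD hδ hη m
    have hsum2 : (m : ℝ) * (m : ℝ) ^ (-(1 + δ) / 2) ≤ r := by
      rcases Nat.eq_zero_or_pos m with h0 | h0
      · rw [h0]; simpa using hr0
      · have hm0 : (0 : ℝ) < m := by exact_mod_cast h0
        have e : (m : ℝ) * (m : ℝ) ^ (-(1 + δ) / 2) = (m : ℝ) ^ ((1 - δ) / 2) := by
          rw [show (1 - δ) / 2 = 1 + -(1 + δ) / 2 by ring, Real.rpow_add hm0, Real.rpow_one]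
        rw [e]
        exact Real.rpow_le_rpow hm0.le (by linarith) (by linarith [hδ.2])
    refine (abs_add_le _ _).trans ?_
    calc _ ≤ ∑ k ∈ Finset.range m, (gammaD δ * ζ * (r * X) *
            (η ^ 2 * n ^ (1 - δ) + ((m - 1 - k : ℕ) + 1 : ℝ)) ^ (-1 - δ / 2) +
          alphaD δ * ζ * (m : ℝ) ^ (-(1 + δ) / 2)) + κ :=
          add_le_add ((Finset.abs_sum_le_sum_abs _ _).trans (Finset.sum_le_sum term)) last
      _ = gammaD δ * ζ * (r * X) * (∑ k ∈ Finset.range m,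
            (η ^ 2 * n ^ (1 - δ) + ((m - 1 - k : ℕ) + 1 : ℝ)) ^ (-1 - δ / 2)) +
          alphaD δ * ζ * ((m : ℝ) * (m : ℝ) ^ (-(1 + δ) / 2)) + κ := by
          rw [Finset.sum_add_distrib, ← Finset.mul_sum]
          simp only [Finset.sum_const, Finset.card_range, nsmul_eq_mul]
          ring
      _ ≤ gammaD δ * ζ * (r * X) * gD δ η + alphaD δ * ζ * r + r * κ := by
          gcongr
          exact le_mul_of_one_le_left hκ0 hr1
      _ = _ := by ring
  refine (LipDiffLE.of_gaussSmooth ε main).mono (le_of_eq ?_)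
  push_cast
  rw [← hn, ← hr, hεr]
  -- The fixed-point equation for `X` turns the collected bounds into exactly `r * X`.
  conv_rhs => rw [← hXeq]
  ring

end Gaussian

/-! ### The enorms as suprema of differences of integrals -/

theorem integral_subNormal (P : Measure ℝ) [IsProbabilityMeasure P] {f : ℝ → ℝ}
    (hf : Measurable f) (hb : ∃ C, ∀ x, |f x| ≤ C) :
    ∫ᵛ x, f x ∂<•(subNormal P) = ∫ x, f x ∂P - ∫ x, f x ∂(gaussianReal 0 1) := by
  obtain ⟨C, hC⟩ := hb
  have h : ∀ (ν : Measure ℝ) [IsProbabilityMeasure ν], ν.toSignedMeasure.Integrable f :=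
    fun ν _ => by
      rw [VectorMeasure.Integrable, Measure.variation_toSignedMeasure]
      exact Integrable.of_bound hf.aestronglyMeasurable C (ae_of_all _ hC)
  rw [subNormal, VectorMeasure.integral_sub_vectorMeasure (h P) (h _),
    VectorMeasure.integral_toSignedMeasure, VectorMeasure.integral_toSignedMeasure]

theorem ofReal_abs_integral_le_zeta {m : ℕ} {g f : ℝ → ℝ} (M : SignedMeasure ℝ)
    (hf : f ∈ testFun m g) : ENNReal.ofReal |∫ᵛ x, f x ∂<•M| ≤ zeta m g M := by
  unfold zeta
  exact le_iSup₂_of_le f hf le_rfl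

theorem mem_testFun_zero_iff {f : ℝ → ℝ} : f ∈ testFun 0 (fun u => u) ↔ BddLip 1 f := by
  refine ⟨fun h => ⟨h.2.1, fun x y => ?_⟩, fun h => ⟨h.continuous.measurable, h.1, ?_, ?_⟩⟩
  · simpa using h.2.2.2 x y
  · intro k hk
    omega
  · simpa using h.2

theorem zeta1_subNormal_le {P : Measure ℝ} [IsProbabilityMeasure P] {K : ℝ}
    (h : LipDiffLE P (gaussianReal 0 1) K) : zeta1 (subNormal P) ≤ ENNReal.ofReal K := by
  refine iSup₂_le fun f hf => ENNReal.ofReal_le_ofReal ?_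
  rw [integral_subNormal P hf.1 hf.2.1]
  exact h f (mem_testFun_zero_iff.1 hf)

theorem lipDiffLE_of_zeta1_ne_top {P : Measure ℝ} [IsProbabilityMeasure P]
    (h : zeta1 (subNormal P) ≠ ∞) :
    LipDiffLE P (gaussianReal 0 1) (zeta1 (subNormal P)).toReal := by
  intro f hf
  have hf' := mem_testFun_zero_iff.2 hf
  rw [← integral_subNormal P hf'.1 hf'.2.1, ← ENNReal.ofReal_le_iff_le_toReal h]
  exact ofReal_abs_integral_le_zeta _ hf'

theorem zeta2_subNormal_le {δ : ℝ} {P : Measure ℝ} [IsProbabilityMeasure P] {K : ℝ}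
    (h : SmoothDiffLE δ P (gaussianReal 0 1) K) : zeta2 δ (subNormal P) ≤ ENNReal.ofReal K := by
  refine iSup₂_le fun f hf => ENNReal.ofReal_le_ofReal ?_
  rw [integral_subNormal P hf.1 hf.2.1]
  exact h f hf

theorem smoothDiffLE_of_zeta2_ne_top {δ : ℝ} {P : Measure ℝ} [IsProbabilityMeasure P]
    (h : zeta2 δ (subNormal P) ≠ ∞) :
    SmoothDiffLE δ P (gaussianReal 0 1) (zeta2 δ (subNormal P)).toReal := by
  intro f hf
  rw [← integral_subNormal P hf.1 hf.2.1, ← ENNReal.ofReal_le_iff_le_toReal h]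
  exact ofReal_abs_integral_le_zeta _ hf

/-! ### Finiteness of the enorms of standardised laws -/

theorem lipDiffLE_of_integrable {P Q : Measure ℝ} [IsProbabilityMeasure P]
    [IsProbabilityMeasure Q] (hP : Integrable id P) (hQ : Integrable id Q) :
    LipDiffLE P Q (∫ x, |x| ∂P + ∫ x, |x| ∂Q) := by
  intro f hf
  have key : ∀ (ν : Measure ℝ) [IsProbabilityMeasure ν], Integrable id ν →
      |∫ x, f x ∂ν - f 0| ≤ ∫ x, |x| ∂ν := fun ν _ hR => by
    have e : ∫ x, f x ∂ν - f 0 = ∫ x, (f x - f 0) ∂ν := by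
      rw [integral_sub (hf.integrable ν) (integrable_const _)]; simp
    rw [e, ← Real.norm_eq_abs]
    refine norm_integral_le_of_norm_le hR.abs (ae_of_all _ fun x => ?_)
    simpa using hf.2 x 0
  have h1 := abs_le.1 (key P hP)
  have h2 := abs_le.1 (key Q hQ)
  rw [abs_le]
  constructor <;> linarith [h1.1, h1.2, h2.1, h2.2]

/-- The mean value inequality is applied twice on the segment from `0` to `x`, starting from `|f₂ t
- f₂ 0| ≤ |x| ^ δ`. The resulting constant `1` is not optimal, but only finiteness is wanted. -/
theorem abs_sub_taylor_two_le {δ : ℝ} (hδ : 0 ≤ δ) {f f₁ f₂ : ℝ → ℝ}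
    (h₁ : ∀ x, HasDerivAt f (f₁ x) x) (h₂ : ∀ x, HasDerivAt f₁ (f₂ x) x)
    (hg : ∀ x y, |f₂ x - f₂ y| ≤ |x - y| ^ δ) (x : ℝ) :
    |f x - (f 0 + f₁ 0 * x + f₂ 0 / 2 * x ^ 2)| ≤ |x| ^ (2 + δ) := by
  have hsub : ∀ t ∈ uIcc 0 x, |t| ≤ |x| := fun t ht => by
    simpa using abs_sub_left_of_mem_uIcc ht
  have h0 : (0 : ℝ) ∈ uIcc 0 x := left_mem_uIcc
  have b1 : ∀ t ∈ uIcc 0 x, ‖f₁ t - f₁ 0 - f₂ 0 * t‖ ≤ |x| ^ δ * |x| := fun t ht => by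
    have := (convex_uIcc 0 x).norm_image_sub_le_of_norm_hasDerivWithin_le
      (f := fun t => f₁ t - f₂ 0 * t) (f' := fun t => f₂ t - f₂ 0) (C := |x| ^ δ)
      (fun s _ => by
        have := (h₂ s).sub ((hasDerivAt_id s).const_mul (f₂ 0))
        exact (this.congr_deriv (by rw [mul_one])).hasDerivWithinAt)
      (fun s hs => (hg s 0).trans (by
        rw [sub_zero]
        exact Real.rpow_le_rpow (abs_nonneg _) (hsub s hs) hδ)) h0 ht
    simp only [mul_zero, sub_zero] at this
    rw [sub_right_comm] at this
    refine this.trans ?_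
    gcongr
    exact hsub t ht
  have b2 := (convex_uIcc 0 x).norm_image_sub_le_of_norm_hasDerivWithin_le
    (f := fun t => f t - (f 0 + f₁ 0 * t + f₂ 0 / 2 * t ^ 2))
    (f' := fun t => f₁ t - f₁ 0 - f₂ 0 * t) (C := |x| ^ δ * |x|)
    (fun s _ => by
      have := (h₁ s).sub ((((hasDerivAt_id s).const_mul (f₁ 0)).const_add (f 0)).add
        ((hasDerivAt_pow 2 s).const_mul (f₂ 0 / 2)))
      exact (this.congr_deriv (by push_cast; ring)).hasDerivWithinAt) b1 h0 right_mem_uIcc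
  have e : |x| ^ (2 + δ) = |x| ^ δ * |x| * |x| := by
    rw [add_comm, Real.rpow_add_of_nonneg (abs_nonneg x) hδ (by norm_num), mul_assoc,
      Real.rpow_two, sq]
  rw [e]
  simpa using b2

theorem integral_quadratic {ν : Measure ℝ} [IsProbabilityMeasure ν] (hR : MemLp id 2 ν)
    (hm : ∫ x, x ∂ν = 0) (hv : ∫ x, x ^ 2 ∂ν = 1) (a b c : ℝ) :
    Integrable (fun x => a + b * x + c * x ^ 2) ν ∧ ∫ x, (a + b * x + c * x ^ 2) ∂ν = a + c := by
  have i1 : Integrable (fun x : ℝ => b * x) ν := (hR.integrable one_le_two).const_mul b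
  have i2 : Integrable (fun x : ℝ => c * x ^ 2) ν := hR.integrable_sq.const_mul c
  refine ⟨((integrable_const a).add i1).add i2, ?_⟩
  rw [integral_add (f := fun x => a + b * x) ((integrable_const a).add i1) i2,
    integral_add (integrable_const a) i1, integral_const_mul, integral_const_mul, hm, hv]
  simp

/-- The two laws share mean and variance, so the second-order Taylor polynomial of the test function
at `0` has the same integral under both. Only the remainders contribute, and the moments of order `2
+ δ` control them. -/
theorem smoothDiffLE_of_memLp {δ : ℝ} (hδ : 0 ≤ δ) {P Q : Measure ℝ} [IsProbabilityMeasure P]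
    [IsProbabilityMeasure Q] (hP : MemLp id (ENNReal.ofReal (2 + δ)) P)
    (hQ : MemLp id (ENNReal.ofReal (2 + δ)) Q) (hPm : ∫ x, x ∂P = 0) (hQm : ∫ x, x ∂Q = 0)
    (hPv : ∫ x, x ^ 2 ∂P = 1) (hQv : ∫ x, x ^ 2 ∂Q = 1) :
    SmoothDiffLE δ P Q (∫ x, |x| ^ (2 + δ) ∂P + ∫ x, |x| ^ (2 + δ) ∂Q) := by
  intro f hf
  obtain ⟨hm, ⟨M, hM⟩, hd, hg⟩ := hf
  have h₁ : ∀ x, HasDerivAt f (deriv f x) x := fun x => by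
    have := hd 0 (by norm_num)
    rw [iteratedDeriv_zero] at this
    exact (this x).hasDerivAt
  have h₂ : ∀ x, HasDerivAt (deriv f) (iteratedDeriv 2 f x) x := fun x => by
    have := hd 1 (by norm_num)
    rw [iteratedDeriv_one] at this
    rw [iteratedDeriv_succ, iteratedDeriv_one]
    exact (this x).hasDerivAt
  have key : ∀ (ν : Measure ℝ) [IsProbabilityMeasure ν], MemLp id (ENNReal.ofReal (2 + δ)) ν →
      ∫ x, x ∂ν = 0 → ∫ x, x ^ 2 ∂ν = 1 →
      |∫ x, f x ∂ν - (f 0 + iteratedDeriv 2 f 0 / 2)| ≤ ∫ x, |x| ^ (2 + δ) ∂ν := by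
    intro ν _ hR hRm hRv
    have hR2 : MemLp id 2 ν := hR.mono_exponent (by
      rw [← ENNReal.ofReal_ofNat]
      exact ENNReal.ofReal_le_ofReal (by linarith))
    obtain ⟨hi, he⟩ := integral_quadratic hR2 hRm hRv (f 0) (deriv f 0) (iteratedDeriv 2 f 0 / 2)
    have hR' : Integrable (fun x : ℝ => |x| ^ (2 + δ)) ν := by
      have := hR.integrable_norm_rpow'
      rwa [ENNReal.toReal_ofReal (by linarith)] at this
    rw [← he, ← integral_sub (Integrable.of_bound hm.aestronglyMeasurable M (ae_of_all _ hM)) hi,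
      ← Real.norm_eq_abs]
    exact norm_integral_le_of_norm_le hR' (ae_of_all _ (abs_sub_taylor_two_le hδ h₁ h₂
      fun x y => (hg x y).trans (min_le_right _ _)))
  have h1 := abs_le.1 (key P hP hPm hPv)
  have h2 := abs_le.1 (key Q hQ hQm hQv)
  rw [abs_le]
  constructor <;> linarith [h1.1, h1.2, h2.1, h2.2]

/-! ### Standardisation -/

theorem MemP.memLp {r : ℝ} (hr : 0 < r) {P : Measure ℝ} (hP : MemP r P) :
    MemLp id (ENNReal.ofReal r) P := by
  refine ⟨measurable_id.aestronglyMeasurable, ?_⟩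
  rw [eLpNorm_lt_top_iff_lintegral_rpow_enorm_lt_top (by simpa using hr) ENNReal.ofReal_ne_top,
    ENNReal.toReal_ofReal hr.le]
  refine lt_of_le_of_lt (lintegral_mono fun x => ?_) hP.2.1
  rw [id, Real.enorm_eq_ofReal_abs, ENNReal.ofReal_rpow_of_nonneg (abs_nonneg x) hr.le]

theorem MemP.memLp_two {r : ℝ} (hr : 2 ≤ r) {P : Measure ℝ} (hP : MemP r P) : MemLp id 2 P := by
  have := hP.1
  refine (hP.memLp (by linarith)).mono_exponent ?_
  rw [← ENNReal.ofReal_ofNat]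
  exact ENNReal.ofReal_le_ofReal hr

theorem memLp_standardize {p : ℝ≥0∞} {P : Measure ℝ} [IsProbabilityMeasure P] (hP : MemLp id p P) :
    MemLp id p (standardize P) := by
  rw [standardize, memLp_map_measure_iff (by fun_prop) (by fun_prop)]
  have := (hP.sub (memLp_const (mean P))).const_mul (stdDev P)⁻¹
  refine this.congr_norm (by fun_prop) (ae_of_all _ fun x => ?_)
  simp [div_eq_inv_mul]

theorem integral_standardize {P : Measure ℝ} [IsProbabilityMeasure P] (hP : MemLp id 2 P) :
    ∫ x, x ∂(standardize P) = 0 := by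
  rw [standardize, integral_map (by fun_prop) (by fun_prop), integral_div,
    integral_sub (f := fun x => x) (hP.integrable one_le_two) (integrable_const _)]
  simp [mean]

theorem stdDev_sq (P : Measure ℝ) : stdDev P ^ 2 = Var[id; P] :=
  Real.sq_sqrt (variance_nonneg _ _)

theorem integral_sq_standardize {P : Measure ℝ} (h0 : 0 < stdDev P) :
    ∫ x, x ^ 2 ∂(standardize P) = 1 := by
  have h : ∫ x, (x - mean P) ^ 2 ∂P = stdDev P ^ 2 := by
    rw [stdDev_sq, variance_eq_integral measurable_id.aemeasurable]
    rfl
  rw [standardize, integral_map (by fun_prop) (by fun_prop)]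
  simp_rw [div_pow]
  rw [integral_div, h, div_self (by positivity)]

/-! ### Moments and rescaling of convolution powers -/

theorem memLp_convPow {P : Measure ℝ} [IsProbabilityMeasure P] (hP : MemLp id 2 P) (n : ℕ) :
    MemLp id 2 (convPow P n) := by
  induction n with
  | zero =>
    rw [convPow]
    exact (memLp_const (0 : ℝ)).ae_eq (by simp [Filter.EventuallyEq])
  | succ n ih =>
    rw [convPow, Measure.conv, memLp_map_measure_iff (by fun_prop) (by fun_prop)]
    exact (ih.comp_fst P).add (hP.comp_snd (convPow P n))

theorem mean_convPow {P : Measure ℝ} [IsProbabilityMeasure P] (hP : MemLp id 2 P) (n : ℕ) :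
    mean (convPow P n) = n * mean P := by
  induction n with
  | zero => simp [convPow, mean]
  | succ n ih =>
    have h1 := (memLp_convPow hP n).integrable one_le_two
    have h2 := hP.integrable one_le_two
    have h3 := (memLp_convPow hP (n + 1)).integrable one_le_two
    rw [convPow] at h3
    rw [mean, convPow, integral_conv (f := fun x => x) h3]
    have : ∀ x : ℝ, ∫ y, (x + y) ∂P = x + mean P := fun x => by
      rw [integral_add (g := fun y => y) (integrable_const _) h2]
      simp [mean]
    simp_rw [this]
    rw [integral_add (f := fun x => x) h1 (integrable_const _), integral_const]
    simp only [probReal_univ, one_smul]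
    rw [show ∫ x, x ∂(convPow P n) = mean (convPow P n) from rfl, ih]
    push_cast
    ring

theorem variance_convPow {P : Measure ℝ} [IsProbabilityMeasure P] (hP : MemLp id 2 P) (n : ℕ) :
    Var[id; convPow P n] = n * Var[id; P] := by
  induction n with
  | zero => simp [convPow]
  | succ n ih =>
    rw [convPow, Measure.conv, variance_map (by fun_prop) (by fun_prop)]
    have := variance_add_prod (memLp_convPow hP n) hP
    rw [ih] at this
    simp only [id] at this
    rw [show (id ∘ fun x : ℝ × ℝ => x.1 + x.2) = fun x => x.1 + x.2 from rfl]
    push_cast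
    rw [this, add_mul, one_mul]

theorem stdDev_convPow {P : Measure ℝ} [IsProbabilityMeasure P] (hP : MemLp id 2 P) (n : ℕ) :
    stdDev (convPow P n) = √n * stdDev P := by
  rw [stdDev, variance_convPow hP, Real.sqrt_mul (by positivity), stdDev]

theorem convPow_map_affine (P : Measure ℝ) [IsProbabilityMeasure P] (a b : ℝ) (n : ℕ) :
    convPow (P.map fun x => a * x + b) n = (convPow P n).map fun x => a * x + n * b := by
  induction n with
  | zero => simp [convPow]
  | succ n ih =>
    rw [convPow, convPow, ih, Measure.conv, Measure.conv,
      Measure.map_prod_map _ _ (by fun_prop) (by fun_prop),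
      Measure.map_map (by fun_prop) (by fun_prop), Measure.map_map (by fun_prop) (by fun_prop)]
    congr 1
    ext x
    simp only [Function.comp, Prod.map]
    push_cast
    ring

/-- Convolution powers commute with affine maps up to multiplying the shift by `n`. The identity
also holds when `stdDev P = 0`, through the convention for division by zero. -/
theorem standardize_convPow {P : Measure ℝ} [IsProbabilityMeasure P] (hP : MemLp id 2 P) (n : ℕ) :
    standardize (convPow P n) = (convPow (standardize P) n).map fun x => x / √n := by
  have h : standardize P = P.map fun x => (stdDev P)⁻¹ * x + -(mean P / stdDev P) := by
    rw [standardize]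
    congr 1
    ext x
    ring
  rw [h, convPow_map_affine, Measure.map_map (by fun_prop) (by fun_prop), standardize,
    mean_convPow hP, stdDev_convPow hP]
  congr 1
  ext x
  simp only [Function.comp]
  rw [mul_comm √(n : ℝ), ← div_div]
  ring

theorem lipDiffLE_standardize_convPow {P : Measure ℝ} [IsProbabilityMeasure P]
    (hP : MemLp id 2 P) {n : ℕ} (hn : 1 ≤ n) {K : ℝ}
    (h : LipDiffLE (convPow (standardize P) n) (gaussianReal 0 n) K) :
    LipDiffLE (standardize (convPow P n)) (gaussianReal 0 1) (K / √n) := by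
  have hn0 : (0 : ℝ) < n := by exact_mod_cast hn
  have hN : gaussianReal 0 1 = (gaussianReal 0 n).map fun x => x / √n := by
    rw [gaussianReal_map_div_const]
    congr 1
    · simp
    · ext
      push_cast
      simp [hn0.ne']
  intro f hf
  have hfc := hf.continuous
  rw [standardize_convPow hP, hN, integral_map (by fun_prop) (by fun_prop),
    integral_map (by fun_prop) (by fun_prop)]
  have := h.abs_integral_sub_le (L := (√n)⁻¹) (by positivity) (f := fun x => f (x / √n)) (by
    have := hf.comp_affine (√n)⁻¹ 0
    simpa [div_eq_inv_mul, abs_of_nonneg (Real.sqrt_nonneg _)] using this)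
  rwa [inv_mul_eq_div] at this

/-! ### The theorem -/

theorem zeta1_standardize_lt_top {P : Measure ℝ} [IsProbabilityMeasure P] (hP : MemLp id 2 P) :
    zeta1 (subNormal (standardize P)) < ∞ :=
  (zeta1_subNormal_le (lipDiffLE_of_integrable ((memLp_standardize hP).integrable one_le_two)
    ((memLp_id_gaussianReal 1).integrable (by simp)))).trans_lt ENNReal.ofReal_lt_top

theorem zeta2_standardize_lt_top {δ : ℝ} (hδ : 0 ≤ δ) {P : Measure ℝ} [IsProbabilityMeasure P]
    (hP : MemP (2 + δ) P) : zeta2 δ (subNormal (standardize P)) < ∞ := by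
  refine (zeta2_subNormal_le (smoothDiffLE_of_memLp hδ
    (memLp_standardize (hP.memLp (by linarith))) (memLp_id_gaussianReal' _ ENNReal.ofReal_ne_top)
    (integral_standardize (hP.memLp_two (by linarith))) integral_id_gaussianReal
    (integral_sq_standardize hP.2.2) ?_)).trans_lt ENNReal.ofReal_lt_top
  have h := variance_eq_sub (memLp_id_gaussianReal (μ := 0) (v := 1) 2)
  simpa [variance_id_gaussianReal] using h.symm

theorem lipDiffLE_standardize_convPow_of_zeta {δ : ℝ} (hδ : δ ∈ Icc (0 : ℝ) 1) {P : Measure ℝ}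
    [IsProbabilityMeasure P] (hP : MemLp id 2 P)
    (hζ : zeta2 δ (subNormal (standardize P)) ≠ ∞) {η : ℝ} (hη : 0 < η)
    (hlt : gammaD δ * gD δ η * (zeta2 δ (subNormal (standardize P))).toReal < 1) {n : ℕ}
    (hn : 1 ≤ n) :
    LipDiffLE (standardize (convPow P n)) (gaussianReal 0 1) (1 / (n : ℝ) ^ (δ / 2) *
      (((zeta1 (subNormal (standardize P))).toReal +
        alphaD δ * (zeta2 δ (subNormal (standardize P))).toReal + betaC * η) /
        (1 - gammaD δ * gD δ η * (zeta2 δ (subNormal (standardize P))).toReal))) := by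
  have hn0 : (0 : ℝ) < n := by exact_mod_cast hn
  refine (lipDiffLE_standardize_convPow hP hn (lipDiffLE_convPow
    (lipDiffLE_of_zeta1_ne_top (zeta1_standardize_lt_top hP).ne)
    (smoothDiffLE_of_zeta2_ne_top hζ) hδ hη hlt n)).mono (le_of_eq ?_)
  rw [mul_div_right_comm, Real.sqrt_eq_rpow, ← Real.rpow_sub hn0, one_div ((n : ℝ) ^ _),
    ← Real.rpow_neg hn0.le]
  congr 2
  ring

theorem zeta1_standardize_convPow_le_xi {δ : ℝ} (hδ : δ ∈ Icc (0 : ℝ) 1) {P : Measure ℝ}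
    [IsProbabilityMeasure P] (hP : MemLp id 2 P)
    (hζ : zeta2 δ (subNormal (standardize P)) ≠ ∞) {n : ℕ} (hn : 1 ≤ n) :
    zeta1 (subNormal (standardize (convPow P n))) ≤ ENNReal.ofReal (1 / (n : ℝ) ^ (δ / 2)) *
      xi δ (zeta1 (subNormal (standardize P))).toNNReal
        (zeta2 δ (subNormal (standardize P))).toNNReal := by
  have hn0 : (0 : ℝ) < n := by exact_mod_cast hn
  have hc : 0 < 1 / (n : ℝ) ^ (δ / 2) := by positivity
  have hc0 : ENNReal.ofReal (1 / (n : ℝ) ^ (δ / 2)) ≠ 0 := by simpa using hc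
  -- The factor is nonzero and finite, so it can be moved to the left, leaving a bare infimum to
  -- bound below.
  rw [← ENNReal.div_le_iff' hc0 ENNReal.ofReal_ne_top]
  refine le_iInf fun η => le_iInf fun hη => le_iInf fun hlt => ?_
  rw [ENNReal.div_le_iff' hc0 ENNReal.ofReal_ne_top, ← ENNReal.ofReal_mul hc.le]
  exact zeta1_subNormal_le (lipDiffLE_standardize_convPow_of_zeta hδ hP hζ hη hlt hn)

open Filter Topology in
-- The natural choice is `η = c ζ`: then `ζ² (1 + 1/η²) = ζ² + 1/c² ≤ θ²/(4γ²)`, which gives `γ g ζ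
-- ≤ θ`. Finiteness of the second enorm comes from the smallness hypothesis, since no moment beyond
-- the second is assumed.
theorem lipDiffLE_standardize_convPow_of_zeta_le {θ c δ : ℝ} (hθ : θ ∈ Ioo (0 : ℝ) 1)
    (hc : 0 < c) (hθc : 0 < θ ^ 2 / (4 * gammaC ^ 2) - 1 / c ^ 2) (hδ : δ ∈ Icc (0 : ℝ) 1)
    {P : Measure ℝ} [IsProbabilityMeasure P] (hP : MemLp id 2 P)
    (hζ : zeta2 δ (subNormal (standardize P)) ≤
      ENNReal.ofReal √(θ ^ 2 / (4 * gammaC ^ 2) - 1 / c ^ 2)) {n : ℕ} (hn : 1 ≤ n) :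
    LipDiffLE (standardize (convPow P n)) (gaussianReal 0 1)
      ((1 + alphaC + betaC * c) / (1 - θ) *
        (max (zeta1 (subNormal (standardize P))).toReal
          (zeta2 δ (subNormal (standardize P))).toReal / (n : ℝ) ^ (δ / 2))) := by
  have hn0 : (0 : ℝ) < n := by exact_mod_cast hn
  have hζtop := ne_top_of_le_ne_top ENNReal.ofReal_ne_top hζ
  set κ := (zeta1 (subNormal (standardize P))).toReal
  set ζ := (zeta2 δ (subNormal (standardize P))).toReal with hζdef
  have hζ0 : 0 ≤ ζ := ENNReal.toReal_nonneg
  have hζle : ζ ^ 2 ≤ θ ^ 2 / (4 * gammaC ^ 2) - 1 / c ^ 2 := by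
    rw [← Real.sq_sqrt hθc.le]
    exact pow_le_pow_left₀ hζ0 (ENNReal.toReal_le_of_le_ofReal (Real.sqrt_nonneg _) hζ) 2
  have hγC : 0 < gammaC := by unfold gammaC; positivity
  have hβ : 0 < betaC := by unfold betaC; positivity
  have hα : 0 < alphaC := (alphaD_pos δ).trans_le (alphaD_le hδ)
  have hθ1 : 0 < 1 - θ := by linarith [hθ.2]
  have hsmall : ∀ η, c * ζ < η → gammaD δ * gD δ η * ζ ≤ θ := fun η hη => by
    have hη0 : 0 < η := lt_of_le_of_lt (by positivity) hη
    have hsq : (√(1 + 1 / η ^ 2) * ζ) ^ 2 ≤ (θ / (2 * gammaC)) ^ 2 := by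
      rw [mul_pow, Real.sq_sqrt (by positivity)]
      have h1 : ζ ^ 2 / η ^ 2 ≤ 1 / c ^ 2 := by
        rw [div_le_div_iff₀ (by positivity) (by positivity), one_mul, ← mul_pow, mul_comm ζ]
        exact pow_le_pow_left₀ (by positivity) hη.le 2
      calc (1 + 1 / η ^ 2) * ζ ^ 2 = ζ ^ 2 + ζ ^ 2 / η ^ 2 := by ring
        _ ≤ θ ^ 2 / (4 * gammaC ^ 2) := by linarith
        _ = _ := by ring
    have h2 : √(1 + 1 / η ^ 2) * ζ ≤ θ / (2 * gammaC) :=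
      le_of_sq_le_sq hsq (div_nonneg hθ.1.le (by positivity))
    calc gammaD δ * gD δ η * ζ ≤ gammaC * (2 * √(1 + 1 / η ^ 2)) * ζ := by
          have := (gD_pos (δ := δ) hη0).le
          gcongr
          · exact gammaD_le hδ
          · exact gD_le hδ hη0
      _ = 2 * gammaC * (√(1 + 1 / η ^ 2) * ζ) := by ring
      _ ≤ 2 * gammaC * (θ / (2 * gammaC)) := by gcongr
      _ = θ := by field_simp
  intro f hf
  have hbound : ∀ η, c * ζ < η →
      |∫ x, f x ∂(standardize (convPow P n)) - ∫ x, f x ∂(gaussianReal 0 1)| ≤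
        1 / (n : ℝ) ^ (δ / 2) * ((κ + alphaD δ * ζ + betaC * η) / (1 - θ)) := fun η hη => by
    have hη0 : 0 < η := lt_of_le_of_lt (by positivity) hη
    have hs := hsmall η hη
    have hκ0 : 0 ≤ κ := ENNReal.toReal_nonneg
    have hαδ := alphaD_pos δ
    refine (lipDiffLE_standardize_convPow_of_zeta hδ hP hζtop hη0 (by linarith [hθ.2]) hn
      f hf).trans ?_
    gcongr
  -- If `ζ = 0`, the value `η = c ζ` is not positive, so it is reached as a limit from the right.
  have hlim : Tendsto (fun η => 1 / (n : ℝ) ^ (δ / 2) *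
      ((κ + alphaD δ * ζ + betaC * η) / (1 - θ))) (𝓝[>] (c * ζ))
      (𝓝 (1 / (n : ℝ) ^ (δ / 2) * ((κ + alphaD δ * ζ + betaC * (c * ζ)) / (1 - θ)))) :=
    Continuous.tendsto' (by fun_prop) _ _ rfl |>.mono_left nhdsWithin_le_nhds
  refine (ge_of_tendsto hlim (eventually_mem_nhdsWithin.mono hbound)).trans ?_
  set M := max κ ζ
  have hκM : κ ≤ M := le_max_left _ _
  have hζM : ζ ≤ M := le_max_right _ _
  calc 1 / (n : ℝ) ^ (δ / 2) * ((κ + alphaD δ * ζ + betaC * (c * ζ)) / (1 - θ))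
      ≤ 1 / (n : ℝ) ^ (δ / 2) * ((M + alphaC * M + betaC * (c * M)) / (1 - θ)) := by
        gcongr
        exact alphaD_le hδ
    _ = _ := by ring

end SenatovZolotarev

end

open SenatovZolotarev in
theorem theorem1p2 :
    -- part (a)
    ((∀ δ ∈ Set.Icc (0 : ℝ) 1,
        (∀ (P : Measure ℝ) [IsProbabilityMeasure P], MemP (2 + δ) P →
          zeta1 (subNormal (standardize P)) < ∞ ∧
          zeta2 δ (subNormal (standardize P)) < ∞ ∧
          ∀ n : ℕ, 1 ≤ n →
            zeta1 (subNormal (standardize (convPow P n))) ≤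
              ENNReal.ofReal (1 / (n : ℝ) ^ (δ / 2)) *
                xi δ (zeta1 (subNormal (standardize P))).toNNReal
                  (zeta2 δ (subNormal (standardize P))).toNNReal) ∧
        (∀ κ ζ : ℝ≥0, xi δ κ ζ = ∞ → δ = 0 ∧ (2 * gammaD 0)⁻¹ ≤ (ζ : ℝ))) ∧
      (2 * gammaD 0)⁻¹ ∈ Set.Ico (0.2582 : ℝ) 0.2583) ∧
    -- part (b)
    (∀ θ ∈ Set.Ioo (0 : ℝ) 1, ∀ c : ℝ, 0 < c →
      0 < θ ^ 2 / (4 * gammaC ^ 2) - 1 / c ^ 2 →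
      ∀ δ ∈ Set.Icc (0 : ℝ) 1, ∀ (P : Measure ℝ) [IsProbabilityMeasure P], MemP 2 P →
        zeta2 δ (subNormal (standardize P)) ≤
          ENNReal.ofReal (Real.sqrt (θ ^ 2 / (4 * gammaC ^ 2) - 1 / c ^ 2)) →
        ∀ n : ℕ, 1 ≤ n →
          zeta1 (subNormal (standardize (convPow P n))) ≤
            ENNReal.ofReal ((1 + alphaC + betaC * c) / (1 - θ)) *
              (max (zeta1 (subNormal (standardize P))) (zeta2 δ (subNormal (standardize P))) /
                ENNReal.ofReal ((n : ℝ) ^ (δ / 2)))) := by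
  refine ⟨⟨fun δ hδ => ⟨fun P _ hP => ?_, fun κ ζ h => xi_eq_top hδ h⟩,
    inv_two_mul_gammaD_zero_mem⟩, fun θ hθ c hc hθc δ hδ P _ hP hζ n hn => ?_⟩
  · have hP2 := hP.memLp_two (by linarith [hδ.1])
    have hζ := zeta2_standardize_lt_top hδ.1 hP
    exact ⟨zeta1_standardize_lt_top hP2, hζ, fun n hn =>
      zeta1_standardize_convPow_le_xi hδ hP2 hζ.ne hn⟩
  · have hP2 := hP.memLp_two le_rfl
    have hn0 : (0 : ℝ) < n := by exact_mod_cast hn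
    have hα : 0 < alphaC := (alphaD_pos δ).trans_le (alphaD_le hδ)
    have hβ : 0 < betaC := by unfold betaC; positivity
    have hθ1 : 0 < 1 - θ := by linarith [hθ.2]
    refine (zeta1_subNormal_le
      (lipDiffLE_standardize_convPow_of_zeta_le hθ hc hθc hδ hP2 hζ hn)).trans_eq ?_
    have hζtop := ne_top_of_le_ne_top ENNReal.ofReal_ne_top hζ
    rw [ENNReal.ofReal_mul (by positivity),
      ENNReal.ofReal_div_of_pos (y := (n : ℝ) ^ (δ / 2)) (by positivity), ENNReal.ofReal_max, ENNReal.ofReal_toReal (zeta1_standardize_lt_top hP2).ne,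
      ENNReal.ofReal_toReal hζtop]
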